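/- Let $\mathbb D$ be the open unit disc, $\mathbb T$ the unit circle with normalized Lebesgue measure, $H^2\subset L^2(\mathbb T)$ and $H^\infty\subset L^\infty(\mathbb T)$ the Hardy spaces, $P$ the orthogonal projection of $L^2(\mathbb T)$ onto $H^2$, $T_\psi f=P(\psi f)$ the Toeplitz operator on $H^2$ with symbol $\psi\in L^\infty(\mathbb T)$, and $S=T_z$ the shift. For $b$ in the closed unit ball of $H^\infty$, let $\mathcal H(b)$ be the range of the operator $(I-T_bT_{\bar b})^{1/2}$ on $H^2$, with the range norm and the corresponding inner product $\langle\cdot,\cdot\rangle_b$. A pair $(b,a)$ consists of such a $b$ and of an outer function $a\in H^\infty$ with $a(0)>0$ and $|a|^2+|b|^2=1$ a.e. on $\mathbb T$; the pair is rational if $a$ and $b$ are rational functions. Let $m\ge 0$, let $\lambda_1,\dots,\lambda_m\in\mathbb T$ (not necessarily distinct), let $p$ be a polynomial of degree at most $m$ with $p(\lambda_j)\neq 0$ for $j=1,\dots,m$, and let $(b,a)$ be a rational pair with $$\frac{b(z)}{a(z)}=\frac{p(z)}{\prod_{j=1}^m(1-\bar\lambda_j z)} .$$ Then $S$ maps $\mathcal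 H(b)$ into itself. Let $Y=S|_{\mathcal H(b)}$, and call $h\in\mathcal H(b)$, $h\ne0$, a wandering vector of $Y$ if $\langle Y^kh,h\rangle_b=0$ for all $k\ge1$. There is a finite Blaschke product $B_m$ of degree $m$ such that, for every wandering vector $h$ of $Y$, the outer part of $h$ (the outer factor $h_0\in H^2$ in the inner-outer factorization $h=uh_0$, which is determined up to a unimodular constant) lies in the model space $H^2\ominus zB_mH^2$. -/

import Mathlib

noncomputable section

open MeasureTheory AddCircle
open scoped ENNReal InnerProductSpace ContinuousLinearMap

namespace DeBrangesRovnyak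

/-! ### The unit circle, `L²` and `L^∞` -/

instance factTwoPiPos : Fact (0 < 2 * Real.pi) := ⟨Real.two_pi_pos⟩

/-- The unit circle, parametrized by the angle `t ∈ ℝ / 2πℤ`; the point is `e^{it}`.
It carries the normalized measure `haarAddCircle = dt / 2π`. -/
abbrev UCircle : Type := AddCircle (2 * Real.pi)

/-- The coordinate function `t ↦ e^{it}`. -/
def zeta (t : UCircle) : ℂ := fourier 1 t

/-- `L²(𝕋)`. -/
abbrev L2T : Type := Lp ℂ 2 (haarAddCircle (T := 2 * Real.pi))

/-- `L^∞(𝕋)`. -/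
abbrev LinfT : Type := Lp ℂ ∞ (haarAddCircle (T := 2 * Real.pi))

/-- The coordinate function `z` as an element of `L^∞(𝕋)`. -/
def zInf : LinfT := fourierLp ∞ 1

/-! ### Hardy spaces, identified with spaces of boundary functions -/

/-- The Hardy space `H²`: the functions in `L²(𝕋)` whose Fourier coefficients of negative index
vanish. -/
def H2 : Submodule ℂ L2T where
  carrier := {f | ∀ n : ℤ, n < 0 → fourierCoeff f n = 0}
  add_mem' := by
    intro f g hf hg n hn
    have hf' := hf n hn
    have hg' := hg n hn
    rw [← fourierBasis_repr] at hf' hg' ⊢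
    simp [hf', hg']
  zero_mem' := by
    intro n _
    rw [← fourierBasis_repr]
    simp
  smul_mem' := by
    intro c f hf n hn
    have hf' := hf n hn
    rw [← fourierBasis_repr] at hf' ⊢
    simp [hf']

theorem isClosed_H2 : IsClosed (H2 : Set L2T) := by
  have h : (H2 : Set L2T) = ⋂ n : ℤ, ⋂ _ : n < 0,
      {f : L2T | ⟪(fourierLp 2 n : L2T), f⟫_ℂ = 0} := by
    ext f
    simp only [Set.mem_iInter, Set.mem_ofPred_eq]
    refine forall_congr' fun n => forall_congr' fun _ => ?_
    rw [← fourierBasis_repr, HilbertBasis.repr_apply_apply, coe_fourierBasis]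
  rw [h]
  refine isClosed_iInter fun n => isClosed_iInter fun _ => ?_
  exact isClosed_eq (by fun_prop) continuous_const

instance completeSpaceH2 : CompleteSpace H2 := isClosed_H2.completeSpace_coe

/-- Membership in `H^∞`, for a function in `L^∞(𝕋)`. -/
def IsHinf (u : LinfT) : Prop := ∀ n : ℤ, n < 0 → fourierCoeff u n = 0

/-- The value at a point `w` of the disc of the analytic function with boundary function `f`. -/
def evalDisc (f : UCircle → ℂ) (w : ℂ) : ℂ := ∑' n : ℕ, fourierCoeff f (n : ℤ) * w ^ n

/-- Inner functions. -/
def IsInner (u : LinfT) : Prop := IsHinf u ∧ ∀ᵐ t ∂haarAddCircle, ‖u t‖ = 1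

/-- Outer functions (in `H¹`, hence in particular in `H²` or `H^∞`): functions of the form
`f(w) = c * exp (∫ (e^{it} + w) / (e^{it} - w) * log |f(e^{it})| dt / 2π)` in the disc, where
`|c| = 1` and `log |f|` is integrable on the circle. -/
def IsOuter (f : UCircle → ℂ) : Prop :=
  Integrable f haarAddCircle ∧ (∀ n : ℤ, n < 0 → fourierCoeff f n = 0) ∧
  (∀ᵐ t ∂haarAddCircle, f t ≠ 0) ∧
  Integrable (fun t => Real.log ‖f t‖) haarAddCircle ∧
  ∃ c : ℂ, ‖c‖ = 1 ∧ ∀ w : ℂ, ‖w‖ < 1 →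
    evalDisc f w = c * Complex.exp
      (∫ t, (zeta t + w) / (zeta t - w) * (Real.log ‖f t‖ : ℂ) ∂haarAddCircle)

/-- `h₀` is an outer part of `h`: it is the outer factor in an inner-outer factorization
`h = u h₀`. (It is determined by `h` up to a unimodular constant.) -/
def IsOuterPart (h₀ h : H2) : Prop :=
  IsOuter (h₀ : L2T) ∧ ∃ u : LinfT, IsInner u ∧
    ∀ᵐ t ∂haarAddCircle, (h : L2T) t = u t * (h₀ : L2T) t

/-! ### Toeplitz operators and model spaces -/

/-- Multiplication by a bounded function, on `L²(𝕋)`. -/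
def mulL (φ : LinfT) : L2T →L[ℂ] L2T :=
  (ContinuousLinearMap.mul ℂ ℂ).holderL haarAddCircle ∞ 2 2 φ

/-- The Toeplitz operator `T_φ f = P (φ f)` on `H²`. -/
def toeplitz (φ : LinfT) : H2 →L[ℂ] H2 :=
  H2.orthogonalProjectionOnto ∘L mulL φ ∘L H2.subtypeL

/-- The shift `S = T_z` on `H²`. -/
def shift : H2 →L[ℂ] H2 := toeplitz zInf

/-- The model space `H² ⊖ θ H²`, for `θ` inner. -/
def modelSpace (θ : LinfT) : Submodule ℂ H2 := (LinearMap.range (toeplitz θ).toLinearMap)ᗮ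

/-- `B` is a finite Blaschke product of degree `m`. -/
def IsFiniteBlaschke (m : ℕ) (B : LinfT) : Prop :=
  ∃ (c : ℂ) (α : Fin m → ℂ), ‖c‖ = 1 ∧ (∀ j, ‖α j‖ < 1) ∧
    ∀ᵐ t ∂haarAddCircle,
      B t = c * ∏ j, (zeta t - α j) / (1 - (starRingEnd ℂ) (α j) * zeta t)

/-! ### Operator range spaces and the spaces `H(b)` -/

section RangeSpace

variable {H : Type*} [NormedAddCommGroup H] [InnerProductSpace ℂ H] [CompleteSpace H]

/-- The positive square root of a positive operator on a Hilbert space. -/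
def opSqrt (A : H →L[ℂ] H) : H →L[ℂ] H := CFC.sqrt A

/-- The range of a bounded operator `A`, to be equipped with the range norm (and not with the
norm of the ambient space): `‖A x‖ = ‖x‖` for `x ⟂ ker A`. -/
def RangeSpace (A : H →L[ℂ] H) : Type _ := ↥(LinearMap.range A.toLinearMap)

namespace RangeSpace

variable (A : H →L[ℂ] H)

instance : AddCommGroup (RangeSpace A) :=
  inferInstanceAs (AddCommGroup ↥(LinearMap.range A.toLinearMap))

instance : Module ℂ (RangeSpace A) :=
  inferInstanceAs (Module ℂ ↥(LinearMap.range A.toLinearMap))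

variable {A}

/-- The inclusion of the range space into the ambient space. -/
def incl : RangeSpace A →ₗ[ℂ] H := (LinearMap.range A.toLinearMap).subtype

theorem incl_injective : Function.Injective (incl (A := A)) :=
  (LinearMap.range A.toLinearMap).injective_subtype

theorem mem_range_iff (f : H) : (∃ x, A x = f) ↔ ∃ y : RangeSpace A, incl y = f :=
  ⟨fun h => ⟨⟨f, h⟩, rfl⟩, fun ⟨y, hy⟩ => hy ▸ y.2⟩

instance completeSpaceKer : CompleteSpace (LinearMap.ker A.toLinearMap) :=
  A.isClosed_ker.completeSpace_coe

theorem existsUnique_pre (f : RangeSpace A) :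
    ∃! x : H, x ∈ (LinearMap.ker A.toLinearMap)ᗮ ∧ A x = incl f := by
  obtain ⟨y, hy⟩ := (mem_range_iff (incl f)).2 ⟨f, rfl⟩
  set K := LinearMap.ker A.toLinearMap with hK
  refine ⟨y - K.starProjection y, ⟨K.sub_starProjection_mem_orthogonal y, ?_⟩, ?_⟩
  · have : A (K.starProjection y) = 0 := (K.starProjection_apply_mem y)
    rw [map_sub, this, sub_zero, hy]
  · rintro x ⟨hx, hAx⟩
    set x' := y - K.starProjection y with hx'
    have h1 : x' ∈ Kᗮ := K.sub_starProjection_mem_orthogonal y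
    have h0 : A (K.starProjection y) = 0 := (K.starProjection_apply_mem y)
    have h2 : A (x - x') = 0 := by
      rw [map_sub, hx', map_sub, h0, hAx, hy]; simp
    have h3 : x - x' ∈ K := h2
    have h4 : x - x' ∈ Kᗮ := Kᗮ.sub_mem hx h1
    have h5 : x - x' = 0 := by
      have := K.inner_right_of_mem_orthogonal h3 h4
      exact inner_self_eq_zero.1 this
    exact sub_eq_zero.1 h5

/-- The unique preimage of `f` that is orthogonal to the kernel. -/
def pre (f : RangeSpace A) : H := (existsUnique_pre f).choose

theorem pre_mem (f : RangeSpace A) : pre f ∈ (LinearMap.ker A.toLinearMap)ᗮ :=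
  (existsUnique_pre f).choose_spec.1.1

theorem map_pre (f : RangeSpace A) : A (pre f) = incl f := (existsUnique_pre f).choose_spec.1.2

theorem pre_unique {f : RangeSpace A} {x : H} (hx : x ∈ (LinearMap.ker A.toLinearMap)ᗮ)
    (h : A x = incl f) : x = pre f := (existsUnique_pre f).choose_spec.2 x ⟨hx, h⟩

theorem pre_add (f g : RangeSpace A) : pre (f + g) = pre f + pre g :=
  (pre_unique (Submodule.add_mem _ (pre_mem f) (pre_mem g)) (by simp [map_pre])).symm

theorem pre_smul (c : ℂ) (f : RangeSpace A) : pre (c • f) = c • pre f :=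
  (pre_unique (Submodule.smul_mem _ c (pre_mem f)) (by simp [map_pre])).symm

variable (A)

/-- The range inner product: `⟪A x, A y⟫ = ⟪x, y⟫` for `x, y ⟂ ker A`. -/
@[reducible] def core : InnerProductSpace.Core ℂ (RangeSpace A) where
  inner f g := ⟪pre f, pre g⟫_ℂ
  conj_inner_symm _ _ := inner_conj_symm _ _
  re_inner_nonneg _ := inner_self_nonneg
  add_left _ _ _ := by simp only [pre_add, inner_add_left]
  smul_left _ _ _ := by simp only [pre_smul, inner_smul_left]
  definite f hf := by
    have h : pre f = 0 := inner_self_eq_zero.1 hf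
    have h' := map_pre f
    rw [h, map_zero] at h'
    exact incl_injective (by rw [← h', map_zero])

instance : NormedAddCommGroup (RangeSpace A) := (core A).toNormedAddCommGroup

instance : InnerProductSpace ℂ (RangeSpace A) := InnerProductSpace.ofCore (core A).toCore

theorem inner_def (f g : RangeSpace A) : ⟪f, g⟫_ℂ = ⟪pre f, pre g⟫_ℂ := rfl

end RangeSpace

end RangeSpace

/-- The operator `(I - T_b T_{b̄})^{1/2}` on `H²`. -/
def defect (b : LinfT) : H2 →L[ℂ] H2 := opSqrt (1 - toeplitz b * toeplitz (star b))

/-- The de Branges–Rovnyak space `H(b)`: the range of `(I - T_b T_{b̄})^{1/2}`, with the range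
inner product. -/
abbrev HB (b : LinfT) : Type := RangeSpace (defect b)

/-- `(b, a)` is a pair: `b` is in the closed unit ball of `H^∞`, and `a ∈ H^∞` is the outer
function with `a(0) > 0` and `|a|² + |b|² = 1` a.e. on the circle. -/
def IsPair (b a : LinfT) : Prop :=
  IsHinf b ∧ ‖b‖ ≤ 1 ∧ IsHinf a ∧ IsOuter a ∧ (∃ r : ℝ, 0 < r ∧ evalDisc a 0 = r) ∧
    ∀ᵐ t ∂haarAddCircle, ‖a t‖ ^ 2 + ‖b t‖ ^ 2 = 1

/-- `u` is (the boundary function of) a rational function. -/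
def IsRational (u : LinfT) : Prop :=
  ∃ P Q : Polynomial ℂ, Q ≠ 0 ∧
    ∀ᵐ t ∂haarAddCircle, u t = P.eval (zeta t) / Q.eval (zeta t)

/-- `(b, a)` is a rational pair. -/
def IsRationalPair (b a : LinfT) : Prop := IsPair b a ∧ IsRational b ∧ IsRational a

/-- A wandering vector of an operator: a nonzero vector that is orthogonal to its orbit under the
positive powers of the operator. -/
def IsWandering {E : Type*} [NormedAddCommGroup E] [InnerProductSpace ℂ E] (Y : E →ₗ[ℂ] E)
    (h : E) : Prop :=
  h ≠ 0 ∧ ∀ k : ℕ, 1 ≤ k → ⟪(Y ^ k) h, h⟫_ℂ = 0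

end DeBrangesRovnyak

end

open DeBrangesRovnyak MeasureTheory AddCircle
open scoped ENNReal

noncomputable section

open MeasureTheory AddCircle Filter Topology
open scoped ENNReal InnerProductSpace ContinuousLinearMap ComplexConjugate

namespace DeBrangesRovnyak

local notation "𝔪" => haarAddCircle (T := 2 * Real.pi)

/-! ### The circle -/

/-! Write `q = ∏ (1 - conj λ_j z)`. The pair has a common denominator: `a = q/R` and `b = p/R`,
where `R` is a polynomial of degree at most `m` without zeros in the closed disc and `|R|² = |p|² +
|q|²` on the circle (`exists_denominator`).

The space `H(b)` consists of the `f` having a partner `g ∈ H²` with `T_b̄ f = T_ā g`, and its inner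
product is that of the pairs `(f, g)` in `H² ⊕ H²` (`HB_structure`). Put `p# = z^m conj p` and `q# =
z^m conj q`, which are polynomials on the circle. For a wandering vector `f` and `n ≥ 1`, the vector
`z^n q q# f` has partner `z^n q p# f`. Its orthogonality to `f`, with `g` eliminated through `T_b̄ f
= T_ā g`, says that the coefficient of `|R f|²` paired with `z^(m+n)` vanishes
(`inner_mulL_wandering`).

The outer part `h₀` has the modulus of `f`, and `R h₀` is cyclic for the shift. A cyclic `F` whose
`|F|²` has trigonometric degree at most `m` is orthogonal to `z^(m+1) H²` (`inner_X_pow_eq_zero`).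
If `B` is the Blaschke product whose zeros are the reflections in the circle of the zeros of `R`
(padded with zeros at the origin), then `B R` is a unimodular multiple of `z^m conj R` on the
circle. Hence `R h₀ ⟂ z^(m+1) H²` turns into `h₀ ⟂ z B H²` (`mem_modelSpace`).

The analytic tool throughout is that outer functions are cyclic (`IsOuter.one_mem_cyc`), obtained
from Jensen's inequality. It is also what makes `R = q/a` a polynomial. -/

theorem continuous_zeta : Continuous zeta := (fourier 1).continuous

theorem zeta_pow (n : ℕ) (t : UCircle) : zeta t ^ n = fourier n t := by
  simp [zeta, fourier_apply]
  rw [← Circle.coe_pow, ← AddCircle.toCircle_nsmul]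

theorem norm_zeta (t : UCircle) : ‖zeta t‖ = 1 := by
  simp only [zeta, fourier_one]; exact Circle.norm_coe _

theorem zeta_mul_conj (t : UCircle) : zeta t * conj (zeta t) = 1 := by
  rw [Complex.mul_conj, Complex.normSq_eq_norm_sq, norm_zeta]; simp

theorem zeta_ne_zero (t : UCircle) : zeta t ≠ 0 := by
  intro h; simpa [h] using norm_zeta t

theorem zeta_injective : Function.Injective zeta := by
  intro s t h
  simp only [zeta, fourier_one] at h
  exact AddCircle.injective_toCircle (by positivity) (Subtype.ext h)

theorem measure_singleton_eq_zero (x : UCircle) : 𝔪 {x} = 0 := by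
  have h := AddCircle.volume_closedBall (T := 2 * Real.pi) (x := x) 0
  rw [volume_eq_smul_haarAddCircle] at h
  simpa [Real.pi_pos.not_ge] using h

theorem measure_finite_eq_zero {s : Set UCircle} (hs : s.Finite) : 𝔪 s = 0 := by
  rw [← Set.biUnion_of_singleton s, measure_biUnion_null_iff hs.countable]
  exact fun x _ => measure_singleton_eq_zero x

theorem ae_eval_zeta_ne_zero {Q : Polynomial ℂ} (hQ : Q ≠ 0) : ∀ᵐ t ∂𝔪, Q.eval (zeta t) ≠ 0 := by
  have h : (zeta ⁻¹' (Q.roots.toFinset : Set ℂ)).Finite :=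
    Set.Finite.preimage zeta_injective.injOn (Finset.finite_toSet _)
  refine measure_mono_null ?_ (measure_finite_eq_zero h)
  intro t ht
  simp at ht
  simp [hQ, ht]

theorem integral_eq_intervalIntegral (A : UCircle → ℝ) :
    ∫ t, A t ∂𝔪 = (2 * Real.pi)⁻¹ * ∫ x in (0:ℝ)..(2*Real.pi), A x := by 
  rw [integral_haarAddCircle, ← AddCircle.intervalIntegral_preimage _ 0]; simp

/-! ### Multiplication operators on `L²` -/

theorem mulL_coeFn (φ : LinfT) (f : L2T) : mulL φ f =ᵐ[𝔪] fun t => φ t * f t :=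
  ContinuousLinearMap.coeFn_holder _ φ f

theorem mulL_eq_iff {φ : LinfT} {f g : L2T} : mulL φ f = g ↔ ∀ᵐ t ∂𝔪, φ t * f t = g t := by
  rw [Lp.ext_iff]
  constructor
  · intro h; filter_upwards [h, mulL_coeFn φ f] with t h1 h2; rw [← h1, h2]
  · intro h; filter_upwards [h, mulL_coeFn φ f] with t h1 h2; rw [← h1, h2]

theorem inner_eq_integral (f g : L2T) : ⟪f, g⟫_ℂ = ∫ t, conj (f t) * g t ∂𝔪 := by
  rw [L2.inner_def]
  simp only [RCLike.inner_apply, mul_comm]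

theorem integrable_conj_mul (f g : L2T) : Integrable (fun t => conj (f t) * g t) 𝔪 := by
  have := L2.integrable_inner (𝕜 := ℂ) f g
  simpa only [RCLike.inner_apply, mul_comm] using this

theorem inner_mulL_left (φ : LinfT) (f g : L2T) : ⟪mulL φ f, g⟫_ℂ = ⟪f, mulL (star φ) g⟫_ℂ := by
  rw [inner_eq_integral, inner_eq_integral]
  refine integral_congr_ae ?_
  filter_upwards [mulL_coeFn φ f, mulL_coeFn (star φ) g, Lp.coeFn_star φ] with t h1 h2 h3
  rw [h1, h2, h3]
  simp; ring

theorem mulL_comm (φ ψ : LinfT) (f : L2T) : mulL φ (mulL ψ f) = mulL ψ (mulL φ f) := by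
  rw [mulL_eq_iff]
  filter_upwards [mulL_coeFn φ f, mulL_coeFn ψ f, mulL_coeFn ψ (mulL φ f)] with t h1 h2 h3
  rw [h2, h3, h1]; ring

/-! ### Polynomials on the circle -/

/-- The restriction of a polynomial to the circle. -/
def polyC (P : Polynomial ℂ) : C(UCircle, ℂ) := ⟨fun t => P.eval (zeta t), by
  have := continuous_zeta; fun_prop⟩

/-- A polynomial as an element of `L^∞`. -/
def polyInf (P : Polynomial ℂ) : LinfT := ContinuousMap.toLp ∞ 𝔪 ℂ (polyC P)

/-- A polynomial as an element of `L²`. -/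
def polyL2 (P : Polynomial ℂ) : L2T := ContinuousMap.toLp 2 𝔪 ℂ (polyC P)

theorem polyInf_coeFn (P : Polynomial ℂ) : polyInf P =ᵐ[𝔪] fun t => P.eval (zeta t) :=
  ContinuousMap.coeFn_toLp 𝔪 _

theorem polyL2_coeFn (P : Polynomial ℂ) : polyL2 P =ᵐ[𝔪] fun t => P.eval (zeta t) :=
  ContinuousMap.coeFn_toLp 𝔪 _

theorem mulL_poly_coeFn (P : Polynomial ℂ) (f : L2T) :
    mulL (polyInf P) f =ᵐ[𝔪] fun t => P.eval (zeta t) * f t := by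
  filter_upwards [mulL_coeFn (polyInf P) f, polyInf_coeFn P] with t h1 h2
  rw [h1, h2]

theorem mulL_poly_poly (P Q : Polynomial ℂ) : mulL (polyInf P) (polyL2 Q) = polyL2 (P * Q) := by
  rw [mulL_eq_iff]
  filter_upwards [polyInf_coeFn P, polyL2_coeFn Q, polyL2_coeFn (P * Q)] with t h1 h2 h3
  rw [h1, h2, h3, Polynomial.eval_mul]

theorem mulL_poly_mul (P Q : Polynomial ℂ) (f : L2T) :
    mulL (polyInf (P * Q)) f = mulL (polyInf P) (mulL (polyInf Q) f) := by
  rw [mulL_eq_iff]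
  filter_upwards [polyInf_coeFn (P * Q), mulL_poly_coeFn P (mulL (polyInf Q) f),
    mulL_poly_coeFn Q f] with t h1 h2 h3
  rw [h1, h2, h3, Polynomial.eval_mul, mul_assoc]

/-- The polynomial multiples of `F`. -/
def polyMul (F : L2T) : Polynomial ℂ →ₗ[ℂ] L2T where
  toFun P := mulL (polyInf P) F
  map_add' P Q := by
    rw [mulL_eq_iff]
    filter_upwards [polyInf_coeFn (P + Q), mulL_poly_coeFn P F, mulL_poly_coeFn Q F,
      Lp.coeFn_add (mulL (polyInf P) F) (mulL (polyInf Q) F)] with t h1 h2 h3 h4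
    rw [h1, h4, Pi.add_apply, h2, h3, Polynomial.eval_add, add_mul]
  map_smul' c P := by
    rw [mulL_eq_iff]
    filter_upwards [polyInf_coeFn (c • P), mulL_poly_coeFn P F,
      Lp.coeFn_smul c (mulL (polyInf P) F)] with t h1 h2 h3
    simp only [RingHom.id_apply]
    rw [h1, h3, Pi.smul_apply, h2, Polynomial.eval_smul, smul_eq_mul, smul_eq_mul, mul_assoc]

theorem polyMul_apply (F : L2T) (P : Polynomial ℂ) : polyMul F P = mulL (polyInf P) F := rfl

/-- The cyclic subspace generated by `F` under multiplication by the coordinate function. -/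
def cyc (F : L2T) : Submodule ℂ L2T := (LinearMap.range (polyMul F)).topologicalClosure

theorem mulL_poly_mem_cyc (F : L2T) (P : Polynomial ℂ) : mulL (polyInf P) F ∈ cyc F :=
  Submodule.le_topologicalClosure _ ⟨P, rfl⟩

theorem mulL_poly_one (F : L2T) : mulL (polyInf 1) F = F := by
  rw [mulL_eq_iff]
  filter_upwards [polyInf_coeFn 1] with t h1
  rw [h1]; simp

theorem mem_cyc_self (F : L2T) : F ∈ cyc F := by
  have h := mulL_poly_mem_cyc F 1
  rwa [mulL_poly_one] at h

theorem isClosed_cyc (F : L2T) : IsClosed (cyc F : Set L2T) :=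
  Submodule.isClosed_topologicalClosure _

theorem cyc_le_of_forall {F : L2T} {M : Submodule ℂ L2T} (hM : IsClosed (M : Set L2T))
    (h : ∀ P, mulL (polyInf P) F ∈ M) : cyc F ≤ M := by
  refine Submodule.topologicalClosure_minimal _ ?_ hM
  rintro x ⟨P, hP⟩
  exact hP ▸ h P

/-- Multiplication by `ψ` is continuous and commutes with multiplication by polynomials. The symbol
need not be analytic, so cyclicity can be transferred through quotients such as `q/a` before these
are known to lie in `H²`. -/
theorem mulL_mem_cyc_mulL {F x : L2T} (ψ : LinfT) (hx : x ∈ cyc F) :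
    mulL ψ x ∈ cyc (mulL ψ F) := by
  rw [cyc, ← SetLike.mem_coe, Submodule.topologicalClosure_coe] at hx ⊢
  refine map_mem_closure (mulL ψ).continuous hx ?_
  rintro y ⟨P, hP⟩
  refine ⟨P, ?_⟩
  rw [← hP, polyMul_apply, polyMul_apply, mulL_comm]

theorem cyc_le_cyc {F G : L2T} (h : F ∈ cyc G) : cyc F ≤ cyc G := by
  refine cyc_le_of_forall (isClosed_cyc _) fun P => ?_
  have h1 := mulL_mem_cyc_mulL (polyInf P) h
  have h2 : cyc (mulL (polyInf P) G) ≤ cyc G :=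
    cyc_le_of_forall (isClosed_cyc G) fun Q => by
      rw [← mulL_poly_mul]
      exact mulL_poly_mem_cyc _ _
  exact h2 h1

/-! ### The Hardy space -/

theorem fourierCoeff_eq_inner (f : L2T) (n : ℤ) :
    fourierCoeff f n = ⟪(fourierLp 2 n : L2T), f⟫_ℂ := by
  rw [← fourierBasis_repr, HilbertBasis.repr_apply_apply, coe_fourierBasis]

theorem polyL2_X_pow (n : ℕ) : polyL2 (Polynomial.X ^ n) = fourierLp 2 (n : ℤ) := by
  rw [Lp.ext_iff]
  filter_upwards [polyL2_coeFn (Polynomial.X ^ n), coeFn_fourierLp (T := 2 * Real.pi) 2 n]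
    with t h1 h2
  rw [h1, h2]; simp [zeta_pow]

theorem mulL_poly_polyL2_one (P : Polynomial ℂ) : mulL (polyInf P) (polyL2 1) = polyL2 P := by
  rw [mulL_poly_poly, mul_one]

theorem fourierLp_mem_H2 (n : ℕ) : (fourierLp 2 (n : ℤ) : L2T) ∈ H2 := by
  intro k hk
  rw [fourierCoeff_eq_inner]
  exact orthonormal_fourier.2 (by omega)

theorem polyL2_mem_H2 (P : Polynomial ℂ) : polyL2 P ∈ H2 := by
  rw [← mulL_poly_polyL2_one, ← polyMul_apply]
  induction P using Polynomial.induction_on' with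
  | add P Q h1 h2 => rw [map_add]; exact H2.add_mem h1 h2
  | monomial n c =>
    rw [← Polynomial.smul_X_eq_monomial, map_smul, polyMul_apply, mulL_poly_polyL2_one,
      polyL2_X_pow]
    exact H2.smul_mem _ (fourierLp_mem_H2 n)

theorem H2_eq_cyc_one : H2 = cyc (polyL2 1) := by
  apply le_antisymm
  · intro f hf
    refine (isClosed_cyc _).mem_of_tendsto (hasSum_fourier_series_L2 f) (Eventually.of_forall ?_)
    intro s
    refine Submodule.sum_mem _ fun n _ => ?_
    rcases lt_or_ge n 0 with hn | hn
    · rw [hf n hn, zero_smul]; exact Submodule.zero_mem _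
    · lift n to ℕ using hn
      refine Submodule.smul_mem _ _ ?_
      rw [← polyL2_X_pow, ← mulL_poly_polyL2_one (Polynomial.X ^ n)]
      exact mulL_poly_mem_cyc _ _
  · refine cyc_le_of_forall isClosed_H2 fun P => ?_
    rw [mulL_poly_polyL2_one]; exact polyL2_mem_H2 P

theorem H2_le_cyc {F : L2T} (h : polyL2 1 ∈ cyc F) : H2 ≤ cyc F := by
  rw [H2_eq_cyc_one]; exact cyc_le_cyc h

theorem one_mem_H2 : polyL2 1 ∈ H2 := polyL2_mem_H2 1

theorem mulL_one_coeFn (φ : LinfT) : mulL φ (polyL2 1) =ᵐ[𝔪] φ := by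
  filter_upwards [mulL_coeFn φ (polyL2 1), polyL2_coeFn 1] with t h1 h2
  rw [h1, h2]; simp

/-- An `H^∞` function is in `H²`, as the product with the constant function `1`. -/
theorem mulL_one_mem_H2 {φ : LinfT} (h : IsHinf φ) : mulL φ (polyL2 1) ∈ H2 := by
  intro n hn
  rw [fourierCoeff_congr_ae (mulL_one_coeFn φ)]; exact h n hn

theorem mulL_mem_H2_of_one {φ : LinfT} (h : mulL φ (polyL2 1) ∈ H2) {f : L2T} (hf : f ∈ H2) :
    mulL φ f ∈ H2 := by
  rw [H2_eq_cyc_one] at hf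
  exact (H2_eq_cyc_one ▸ cyc_le_cyc (H2_eq_cyc_one ▸ h)) (mulL_mem_cyc_mulL φ hf)

theorem mulL_poly_mem_H2 (P : Polynomial ℂ) {f : L2T} (hf : f ∈ H2) : mulL (polyInf P) f ∈ H2 :=
  mulL_mem_H2_of_one (by rw [mulL_poly_polyL2_one]; exact polyL2_mem_H2 P) hf

theorem cyc_le_H2 {F : L2T} (h : F ∈ H2) : cyc F ≤ H2 :=
  cyc_le_of_forall isClosed_H2 fun P => mulL_poly_mem_H2 P h

theorem fourierCoeff_mulL_X_pow {f : L2T} (hf : f ∈ H2) {k : ℕ} (hk : 1 ≤ k) :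
    fourierCoeff (mulL (polyInf (Polynomial.X ^ k)) f) 0 = 0 := by
  have h : fourierCoeff (mulL (polyInf (Polynomial.X ^ k)) f) 0 = fourierCoeff f (-(k : ℤ)) := by
    rw [fourierCoeff, fourierCoeff]
    refine integral_congr_ae ?_
    filter_upwards [mulL_poly_coeFn (Polynomial.X ^ k) f] with t h
    rw [h]
    simp [zeta_pow]
  rw [h]; exact hf _ (by omega)

/-! ### Jensen's inequality -/

/-- The shift by `ε` makes the logarithm Lipschitz, so that `g ↦ ∫ log (|g| + ε)` is continuous on
`L²` and Jensen's inequality passes from polynomials to their closure. -/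
theorem log_add_sub_log_add_le {x y ε : ℝ} (hx : 0 ≤ x) (hy : 0 ≤ y) (hε : 0 < ε) :
    |Real.log (x + ε) - Real.log (y + ε)| ≤ ε⁻¹ * |x - y| := by
  have key : ∀ {x y : ℝ}, 0 ≤ x → 0 ≤ y →
      Real.log (x + ε) - Real.log (y + ε) ≤ ε⁻¹ * |x - y| := by
    intro x y hx hy
    rw [← Real.log_div (by positivity) (by positivity)]
    refine (Real.log_le_sub_one_of_pos (by positivity)).trans ?_
    have h1 : (x + ε) / (y + ε) - 1 = (x - y) * (y + ε)⁻¹ := by field_simp; ring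
    rw [h1, mul_comm ε⁻¹]
    have h2 : (y + ε)⁻¹ ≤ ε⁻¹ := inv_anti₀ hε (by linarith)
    exact mul_le_mul (le_abs_self _) h2 (by positivity) (abs_nonneg _)
  rw [abs_le]
  have h1 := key hx hy
  have h2 := key hy hx
  rw [abs_sub_comm y x] at h2
  constructor <;> linarith

theorem integrable_norm_L2 (g : L2T) : Integrable (fun t => ‖g t‖) 𝔪 :=
  ((Lp.memLp g).integrable (by norm_num)).norm

theorem integral_norm_le (g : L2T) : ∫ t, ‖g t‖ ∂𝔪 ≤ ‖g‖ := by
  have h1 : ∫ t, ‖g t‖ ∂𝔪 = (eLpNorm g 1 𝔪).toReal := by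
    rw [integral_norm_eq_lintegral_enorm (Lp.aestronglyMeasurable g), eLpNorm_one_eq_lintegral_enorm]
  rw [h1, Lp.norm_def]
  refine ENNReal.toReal_mono (Lp.eLpNorm_ne_top g) ?_
  exact eLpNorm_le_eLpNorm_of_exponent_le (by norm_num) (Lp.aestronglyMeasurable g)

theorem integrable_log_norm_add (g : L2T) {ε : ℝ} (hε : 0 < ε) :
    Integrable (fun t => Real.log (‖g t‖ + ε)) 𝔪 := by
  have hm : AEStronglyMeasurable (fun t => Real.log (‖g t‖ + ε)) 𝔪 :=
    (Real.measurable_log.comp_aemeasurable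
      ((Lp.aestronglyMeasurable g).norm.aemeasurable.add_const ε)).aestronglyMeasurable
  refine Integrable.mono' (((integrable_norm_L2 g).const_mul ε⁻¹).add
    (integrable_const |Real.log ε|)) hm (Eventually.of_forall fun t => ?_)
  have h := log_add_sub_log_add_le (norm_nonneg (g t)) le_rfl hε
  rw [zero_add, sub_zero, abs_norm] at h
  simp only [Pi.add_apply, Real.norm_eq_abs]
  have h2 := abs_sub_abs_le_abs_sub (Real.log (‖g t‖ + ε)) (Real.log ε)
  linarith

theorem continuous_integral_log_norm_add {ε : ℝ} (hε : 0 < ε) :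
    Continuous fun g : L2T => ∫ t, Real.log (‖g t‖ + ε) ∂𝔪 := by
  have h : LipschitzWith (Real.toNNReal ε⁻¹) fun g : L2T => ∫ t, Real.log (‖g t‖ + ε) ∂𝔪 := by
    refine LipschitzWith.of_dist_le_mul fun g h => ?_
    rw [Real.dist_eq, ← integral_sub (integrable_log_norm_add g hε) (integrable_log_norm_add h hε),
      Real.coe_toNNReal _ (by positivity), dist_eq_norm]
    refine abs_integral_le_integral_abs.trans ?_
    have h2 : ∫ t, |Real.log (‖g t‖ + ε) - Real.log (‖h t‖ + ε)| ∂𝔪 ≤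
        ∫ t, ε⁻¹ * ‖(g - h) t‖ ∂𝔪 := by
      refine integral_mono_ae
        ((integrable_log_norm_add g hε).sub (integrable_log_norm_add h hε)).abs
        ((integrable_norm_L2 _).const_mul _) ?_
      filter_upwards [Lp.coeFn_sub g h] with t ht
      rw [ht]
      refine (log_add_sub_log_add_le (norm_nonneg _) (norm_nonneg _) hε).trans ?_
      gcongr
      exact abs_norm_sub_norm_le _ _
    refine h2.trans ?_
    rw [integral_const_mul]
    exact mul_le_mul_of_nonneg_left (integral_norm_le _) (by positivity)
  exact h.continuous

theorem zeta_coe (x : ℝ) : zeta (x : UCircle) = circleMap 0 1 x := by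
  rw [zeta, fourier_coe_apply]
  simp only [circleMap, Int.cast_one, mul_one, Complex.ofReal_one, zero_add, one_mul,
    Complex.ofReal_mul, Complex.ofReal_ofNat]
  congr 1
  have : (Real.pi : ℂ) ≠ 0 := by exact_mod_cast Real.pi_ne_zero
  field_simp

theorem fourierCoeff_polyL2 (P : Polynomial ℂ) : fourierCoeff (polyL2 P) 0 = P.coeff 0 := by
  have h : P = Polynomial.X * P.divX + Polynomial.C (P.coeff 0) := (Polynomial.X_mul_divX_add P).symm
  have h1 : polyL2 P = mulL (polyInf (Polynomial.X ^ 1)) (polyL2 P.divX)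
      + P.coeff 0 • (fourierLp 2 ((0 : ℕ) : ℤ) : L2T) := by
    rw [← polyL2_X_pow, mulL_poly_poly, Lp.ext_iff]
    filter_upwards [polyL2_coeFn P, polyL2_coeFn (Polynomial.X ^ 1 * P.divX),
      polyL2_coeFn (Polynomial.X ^ 0), Lp.coeFn_add (polyL2 (Polynomial.X ^ 1 * P.divX))
        (P.coeff 0 • polyL2 (Polynomial.X ^ 0)), Lp.coeFn_smul (P.coeff 0)
          (polyL2 (Polynomial.X ^ 0))] with t h1 h2 h3 h4 h5
    rw [h1, h4, Pi.add_apply, h5, Pi.smul_apply, h2, h3]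
    conv_lhs => rw [h]
    simp only [Polynomial.eval_add, Polynomial.eval_mul, Polynomial.eval_X, Polynomial.eval_C,
      pow_one, pow_zero, Polynomial.eval_one, smul_eq_mul, mul_one]
  have h2 := fourierCoeff_mulL_X_pow (polyL2_mem_H2 P.divX) le_rfl
  rw [fourierCoeff_eq_inner] at h2 ⊢
  rw [h1, inner_add_right, h2, inner_smul_right]
  have h3 := orthonormal_fourier (T := 2 * Real.pi) |>.1 0
  rw [Nat.cast_zero, inner_self_eq_norm_sq_to_K, h3]
  simp

/-- The Mahler measure `exp ∫ log |P|` bounds each coefficient up to a binomial factor, which is `1`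
for the constant term. -/
theorem norm_coeff_zero_le (P : Polynomial ℂ) {ε : ℝ} (hε : 0 < ε) :
    ‖P.coeff 0‖ ≤ Real.exp (∫ t, Real.log (‖polyL2 P t‖ + ε) ∂𝔪) := by
  by_cases hP : P = 0
  · simp [hP]; positivity
  have h := P.norm_coeff_le_choose_mul_mahlerMeasure 0
  rw [Nat.choose_zero_right, Nat.cast_one, one_mul, Polynomial.mahlerMeasure_def_of_ne_zero hP] at h
  refine h.trans (Real.exp_le_exp.2 ?_)
  have e1 : ∫ t, Real.log (‖polyL2 P t‖ + ε) ∂𝔪 =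
      ∫ t, Real.log (‖P.eval (zeta t)‖ + ε) ∂𝔪 := by
    refine integral_congr_ae ?_
    filter_upwards [polyL2_coeFn P] with t ht
    rw [ht]
  rw [e1, integral_eq_intervalIntegral]
  simp only [zeta_coe]
  refine mul_le_mul_of_nonneg_left ?_ (by positivity)
  have hc : Continuous fun x : ℝ => Real.log (‖P.eval (circleMap 0 1 x)‖ + ε) := by
    refine Continuous.log ?_ fun x => by positivity
    have := continuous_circleMap 0 1
    fun_prop
  refine intervalIntegral.integral_mono_ae (by positivity)
    P.intervalIntegrable_mahlerMeasure (hc.intervalIntegrable _ _) ?_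
  have hz : (circleMap 0 1 ⁻¹' (P.roots.toFinset : Set ℂ)).Countable :=
    (Finset.countable_toSet _).preimage_circleMap 0 one_ne_zero
  filter_upwards [hz.ae_notMem volume] with x hx
  have h0 : P.eval (circleMap 0 1 x) ≠ 0 := by simpa [hP] using hx
  exact Real.log_le_log (norm_pos_iff.2 h0) (by linarith)

theorem continuous_fourierCoeff (n : ℤ) : Continuous fun g : L2T => fourierCoeff g n := by
  simp only [fourierCoeff_eq_inner]
  fun_prop

theorem norm_fourierCoeff_zero_le_add {g : L2T} (hg : g ∈ H2) {ε : ℝ} (hε : 0 < ε) :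
    ‖fourierCoeff g 0‖ ≤ Real.exp (∫ t, Real.log (‖g t‖ + ε) ∂𝔪) := by
  rw [H2_eq_cyc_one, cyc, ← SetLike.mem_coe, Submodule.topologicalClosure_coe] at hg
  have hc : IsClosed {g : L2T | ‖fourierCoeff g 0‖ ≤
      Real.exp (∫ t, Real.log (‖g t‖ + ε) ∂𝔪)} :=
    isClosed_le (continuous_fourierCoeff 0).norm
      (Real.continuous_exp.comp (continuous_integral_log_norm_add hε))
  refine closure_minimal ?_ hc hg
  rintro _ ⟨P, rfl⟩
  rw [polyMul_apply, mulL_poly_polyL2_one]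
  change ‖_‖ ≤ _
  rw [fourierCoeff_polyL2]
  exact norm_coeff_zero_le P hε

/-- **Jensen's inequality** for functions in `H²`. -/
theorem norm_fourierCoeff_zero_le {g : L2T} (hg : g ∈ H2) (hne : ∀ᵐ t ∂𝔪, g t ≠ 0)
    (hlog : Integrable (fun t => Real.log ‖g t‖) 𝔪) :
    ‖fourierCoeff g 0‖ ≤ Real.exp (∫ t, Real.log ‖g t‖ ∂𝔪) := by
  have hu : Tendsto (fun n : ℕ => (1 : ℝ) / (n + 1)) atTop (𝓝 0) :=
    tendsto_one_div_add_atTop_nhds_zero_nat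
  have hlim : Tendsto (fun n : ℕ => ∫ t, Real.log (‖g t‖ + 1 / (n + 1)) ∂𝔪) atTop
      (𝓝 (∫ t, Real.log ‖g t‖ ∂𝔪)) := by
    -- The dominating function comes from `log |g| ≤ log (|g| + 1/(n+1))` on one side and from `log
    -- x ≤ x - 1` with `1/(n+1) ≤ 1` on the other.
    refine tendsto_integral_of_dominated_convergence
      (fun t => |Real.log ‖g t‖| + ‖g t‖) ?_ (hlog.abs.add (integrable_norm_L2 g)) ?_ ?_
    · exact fun n => (integrable_log_norm_add g (by positivity)).aestronglyMeasurable
    · intro n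
      filter_upwards [hne] with t ht
      have h0 : 0 < ‖g t‖ := norm_pos_iff.2 ht
      have h1 : (0 : ℝ) < 1 / (n + 1) := by positivity
      have h2 : (1 : ℝ) / (n + 1) ≤ 1 := by
        rw [div_le_one (by positivity)]; linarith [(Nat.cast_nonneg n : (0 : ℝ) ≤ n)]
      have h3 : Real.log ‖g t‖ ≤ Real.log (‖g t‖ + 1 / (n + 1)) :=
        Real.log_le_log h0 (by linarith)
      have h4 := Real.log_le_sub_one_of_pos (show 0 < ‖g t‖ + 1 / ((n : ℝ) + 1) by positivity)
      have h5 := neg_abs_le (Real.log ‖g t‖)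
      have h6 := abs_nonneg (Real.log ‖g t‖)
      rw [Real.norm_eq_abs, abs_le]
      constructor <;> linarith
    · filter_upwards [hne] with t ht
      have h1 : Tendsto (fun n : ℕ => ‖g t‖ + (1 : ℝ) / (n + 1)) atTop (𝓝 ‖g t‖) := by
        simpa using hu.const_add ‖g t‖
      exact h1.log (norm_ne_zero_iff.2 ht)
  exact ge_of_tendsto' ((Real.continuous_exp.tendsto _).comp hlim)
    fun n => norm_fourierCoeff_zero_le_add hg (by positivity)

/-! ### Outer functions are cyclic -/

theorem continuous_mulL : Continuous mulL :=
  ((ContinuousLinearMap.mul ℂ ℂ).holderL 𝔪 ∞ 2 2).continuous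

/-- A continuous function as an element of `L^∞`. -/
def contInf (φ : C(UCircle, ℂ)) : LinfT := ContinuousMap.toLp ∞ 𝔪 ℂ φ

theorem contInf_coeFn (φ : C(UCircle, ℂ)) : contInf φ =ᵐ[𝔪] φ := ContinuousMap.coeFn_toLp 𝔪 _

theorem inner_mulL_contInf (φ : C(UCircle, ℂ)) (G : L2T) :
    ⟪G, mulL (contInf φ) G⟫_ℂ = ∫ t, φ t * (‖G t‖ ^ 2 : ℝ) ∂𝔪 := by
  rw [inner_eq_integral]
  refine integral_congr_ae ?_
  filter_upwards [mulL_coeFn (contInf φ) G, contInf_coeFn φ] with t h1 h2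
  rw [h1, h2, mul_left_comm, Complex.conj_mul']
  simp

theorem integrable_norm_sq (G : L2T) : Integrable (fun t => ‖G t‖ ^ 2) 𝔪 :=
  (Lp.memLp G).integrable_norm_pow (by norm_num)

theorem integral_norm_sq (G : L2T) : ∫ t, ‖G t‖ ^ 2 ∂𝔪 = ‖G‖ ^ 2 := by
  have h := inner_eq_integral G G
  rw [inner_self_eq_norm_sq_to_K] at h
  have h2 : ∫ t, conj (G t) * G t ∂𝔪 = ((∫ t, ‖G t‖ ^ 2 ∂𝔪 : ℝ) : ℂ) := by
    rw [← integral_complex_ofReal]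
    refine integral_congr_ae (Eventually.of_forall fun t => ?_)
    simp [Complex.conj_mul']
  rw [h2] at h
  have h3 := congrArg Complex.re h.symm
  simpa [← Complex.ofReal_pow] using h3

/-- A function in `L²` that is orthogonal to its orbit under the positive powers of `z` has
constant modulus. -/
theorem norm_eq_const_of_wandering {G : L2T}
    (hG : ∀ k : ℕ, 1 ≤ k → ⟪mulL (polyInf (Polynomial.X ^ k)) G, G⟫_ℂ = 0) :
    ∀ᵐ t ∂𝔪, ‖G t‖ = ‖G‖ := by
  set d := ‖G‖ with hd
  have hint : ∀ φ : C(UCircle, ℂ), Integrable (fun t => φ t * (‖G t‖ ^ 2 : ℝ)) 𝔪 := by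
    intro φ
    exact (integrable_norm_sq G).ofReal.bdd_mul φ.continuous.aestronglyMeasurable
      (Eventually.of_forall φ.norm_coe_le_norm)
  have hX : ∀ k : ℕ, contInf (fourier k) = polyInf (Polynomial.X ^ k) := by
    intro k
    rw [Lp.ext_iff]
    filter_upwards [contInf_coeFn (fourier k), polyInf_coeFn (Polynomial.X ^ k)] with t h1 h2
    rw [h1, h2]; simp [zeta_pow]
  have hpos : ∀ k : ℕ, 1 ≤ k → ∫ t, fourier k t * (‖G t‖ ^ 2 : ℝ) ∂𝔪 = 0 := by
    intro k hk
    rw [← inner_mulL_contInf, hX, ← inner_conj_symm, hG k hk, map_zero]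
  -- The measures with densities `|G|²` and `d²` have the same Fourier coefficients: those of
  -- negative index follow by conjugation. Density of trigonometric polynomials extends the equality
  -- to continuous functions, so the measures and then the densities agree.
  have key : ∀ φ : C(UCircle, ℂ), ∫ t, φ t * (‖G t‖ ^ 2 : ℝ) ∂𝔪 = d ^ 2 * ∫ t, φ t ∂𝔪 := by
    intro φ
    have hcl : IsClosed {φ : C(UCircle, ℂ) | ∫ t, φ t * (‖G t‖ ^ 2 : ℝ) ∂𝔪 = d ^ 2 * ∫ t, φ t ∂𝔪} := by
      have h1 : Continuous fun φ : C(UCircle, ℂ) => ∫ t, φ t * (‖G t‖ ^ 2 : ℝ) ∂𝔪 := by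
        simp only [← inner_mulL_contInf]
        have : Continuous fun φ : C(UCircle, ℂ) => mulL (contInf φ) G :=
          (continuous_mulL.comp (ContinuousMap.toLp ∞ 𝔪 ℂ).continuous).clm_apply continuous_const
        fun_prop
      have h2 : Continuous fun φ : C(UCircle, ℂ) => ∫ t, φ t ∂𝔪 := by
        have h3 : ∀ φ : C(UCircle, ℂ),
            ∫ t, φ t ∂𝔪 = ⟪polyL2 1, ContinuousMap.toLp 2 𝔪 ℂ φ⟫_ℂ := by
          intro φ
          rw [inner_eq_integral]
          refine integral_congr_ae ?_
          filter_upwards [polyL2_coeFn 1, ContinuousMap.coeFn_toLp (p := 2) (𝕜 := ℂ) 𝔪 φ]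
            with t h1 h2
          rw [h1, h2]; simp
        simp only [h3]
        exact continuous_const.inner (ContinuousMap.toLp 2 𝔪 ℂ).continuous
      exact isClosed_eq h1 (continuous_const.mul h2)
    have hmem : φ ∈ (Submodule.span ℂ (Set.range (fourier (T := 2 * Real.pi)))).topologicalClosure := by
      rw [span_fourier_closure_eq_top]; trivial
    rw [← SetLike.mem_coe, Submodule.topologicalClosure_coe] at hmem
    refine closure_minimal ?_ hcl hmem
    intro ψ hψ
    induction hψ using Submodule.span_induction with
    | mem x hx =>
      obtain ⟨n, rfl⟩ := hx
      change ∫ t, fourier n t * (‖G t‖ ^ 2 : ℝ) ∂𝔪 = d ^ 2 * ∫ t, fourier n t ∂𝔪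
      have hint0 : n ≠ 0 → ∫ t, fourier n t ∂𝔪 = 0 := by
        intro hn
        have := fourierCoeff_fourier (T := 2 * Real.pi) n
        have h2 : fourierCoeff (fourier (T := 2 * Real.pi) n) 0 = ∫ t, fourier n t ∂𝔪 := by
          simp [fourierCoeff]
        rw [← h2, this, Pi.single_eq_of_ne hn.symm]
      rcases lt_trichotomy n 0 with hn | rfl | hn
      · rw [hint0 hn.ne, mul_zero]
        obtain ⟨k, rfl⟩ : ∃ k : ℕ, n = -(k : ℤ) := ⟨n.natAbs, by omega⟩
        have h3 := hpos k (by omega)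
        have h4 : ∫ t, fourier (-(k : ℤ)) t * (‖G t‖ ^ 2 : ℝ) ∂𝔪 =
            conj (∫ t, fourier k t * (‖G t‖ ^ 2 : ℝ) ∂𝔪) := by
          rw [← integral_conj]
          refine integral_congr_ae (Eventually.of_forall fun t => ?_)
          simp only [fourier_neg, map_mul, Complex.conj_ofReal]
        rw [h4, h3, map_zero]
      · simp only [fourier_zero, one_mul, integral_const, probReal_univ, one_smul, mul_one]
        rw [integral_complex_ofReal, integral_norm_sq]; simp [hd]
      · rw [hint0 hn.ne', mul_zero]
        obtain ⟨k, rfl⟩ : ∃ k : ℕ, n = (k : ℤ) := ⟨n.natAbs, by omega⟩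
        exact hpos k (by omega)
    | zero => simp
    | add x y _ _ hx hy =>
      simp only [Set.mem_ofPred_eq] at hx hy ⊢
      simp only [ContinuousMap.add_apply, add_mul]
      rw [integral_add (hint x) (hint y), hx, hy, integral_add, mul_add]
      · exact x.continuous.integrable_of_hasCompactSupport (HasCompactSupport.of_compactSpace _)
      · exact y.continuous.integrable_of_hasCompactSupport (HasCompactSupport.of_compactSpace _)
    | smul c x _ hx =>
      simp only [Set.mem_ofPred_eq] at hx ⊢
      simp only [ContinuousMap.smul_apply, smul_eq_mul, mul_assoc]
      rw [integral_const_mul, hx, integral_const_mul, mul_left_comm]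
  have hfin : IsFiniteMeasure (Measure.withDensity 𝔪 fun t => ENNReal.ofReal (‖G t‖ ^ 2)) :=
    isFiniteMeasure_withDensity_ofReal (integrable_norm_sq G).2
  have hfin2 : IsFiniteMeasure (Measure.withDensity 𝔪 fun _ => ENNReal.ofReal (d ^ 2)) :=
    isFiniteMeasure_withDensity_ofReal (integrable_const (d ^ 2)).2
  have hmeas : AEMeasurable (fun t => ENNReal.ofReal (‖G t‖ ^ 2)) 𝔪 :=
    (integrable_norm_sq G).aestronglyMeasurable.aemeasurable.ennreal_ofReal
  have heq : (Measure.withDensity 𝔪 fun t => ENNReal.ofReal (‖G t‖ ^ 2)) =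
      Measure.withDensity 𝔪 fun _ => ENNReal.ofReal (d ^ 2) := by
    refine ext_of_forall_integral_eq_of_IsFiniteMeasure fun f => ?_
    rw [integral_withDensity_eq_integral_toReal_smul₀ hmeas (by simp),
      integral_withDensity_eq_integral_toReal_smul₀ (by fun_prop) (by simp)]
    have h := key ⟨fun t => (f t : ℂ), by fun_prop⟩
    simp only [ContinuousMap.coe_mk, ← Complex.ofReal_mul] at h
    rw [integral_complex_ofReal, integral_complex_ofReal] at h
    have h' : ∫ t, f t * ‖G t‖ ^ 2 ∂𝔪 = d ^ 2 * ∫ t, f t ∂𝔪 := by exact_mod_cast h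
    simp only [ENNReal.toReal_ofReal (sq_nonneg _), smul_eq_mul]
    rw [integral_const_mul, ← h']
    simp only [mul_comm]
  rw [withDensity_eq_iff_of_sigmaFinite hmeas (by fun_prop)] at heq
  filter_upwards [heq] with t ht
  rw [ENNReal.ofReal_eq_ofReal_iff (by positivity) (by positivity)] at ht
  exact (sq_eq_sq₀ (norm_nonneg _) (norm_nonneg _)).1 ht

theorem exists_conj_Linf {G : L2T} {d : ℝ} (hG : ∀ᵐ t ∂𝔪, ‖G t‖ = d) :
    ∃ u : LinfT, ∀ᵐ t ∂𝔪, u t = conj (G t) := by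
  have h : MemLp (fun t => conj (G t)) ∞ 𝔪 := by
    refine memLp_top_of_bound (Complex.continuous_conj.comp_aestronglyMeasurable
      (Lp.aestronglyMeasurable G)) d ?_
    filter_upwards [hG] with t ht
    simp [ht]
  exact ⟨h.toLp, h.coeFn_toLp⟩

theorem one_eq_fourierLp : polyL2 1 = fourierLp 2 0 := by
  simpa using polyL2_X_pow 0

/-- If equality holds in Jensen's inequality at the origin, then `F` is cyclic. -/
theorem one_mem_cyc_of_norm_fourierCoeff {F : L2T} (hF : F ∈ H2) (hne : ∀ᵐ t ∂𝔪, F t ≠ 0)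
    (hlog : Integrable (fun t => Real.log ‖F t‖) 𝔪)
    (h0 : ‖fourierCoeff F 0‖ = Real.exp (∫ t, Real.log ‖F t‖ ∂𝔪)) : polyL2 1 ∈ cyc F := by
  -- As in Beurling's theorem, the component `G` of `F` orthogonal to `z · cyc F` is wandering,
  -- hence of constant modulus. It remains to show that `G` is a constant function.
  set N := cyc (mulL (polyInf Polynomial.X) F) with hN
  have : CompleteSpace N := (isClosed_cyc _).completeSpace_coe
  set G := F - N.starProjection F with hGdef
  have hNF : N ≤ cyc F := cyc_le_cyc (mulL_poly_mem_cyc F _)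
  have hGorth : G ∈ Nᗮ := N.sub_starProjection_mem_orthogonal F
  have hGF : G ∈ cyc F := (cyc F).sub_mem (mem_cyc_self F) (hNF (N.starProjection_apply_mem F))
  have hGN : ∀ x ∈ N, ⟪x, G⟫_ℂ = 0 := fun x hx => N.inner_right_of_mem_orthogonal hx hGorth
  have hshift : ∀ k : ℕ, 1 ≤ k → ∀ x ∈ cyc F, mulL (polyInf (Polynomial.X ^ k)) x ∈ N := by
    intro k hk x hx
    obtain ⟨k, rfl⟩ := Nat.exists_eq_add_of_le' hk
    have h1 : cyc (mulL (polyInf (Polynomial.X ^ (k + 1))) F) ≤ N := by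
      refine cyc_le_cyc ?_
      rw [pow_succ, mulL_poly_mul]
      exact mulL_poly_mem_cyc _ _
    exact h1 (mulL_mem_cyc_mulL _ hx)
  have hGconst := norm_eq_const_of_wandering (G := G) fun k hk => hGN _ (hshift k hk G hGF)
  have hcoeffN : ∀ x ∈ N, fourierCoeff x 0 = 0 := by
    have hle : N ≤ LinearMap.ker (innerSL ℂ (fourierLp 2 0 : L2T)).toLinearMap := by
      refine cyc_le_of_forall (innerSL ℂ (fourierLp 2 0 : L2T)).isClosed_ker fun P => ?_
      rw [mulL_comm, LinearMap.mem_ker]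
      have := fourierCoeff_mulL_X_pow (mulL_poly_mem_H2 P hF) le_rfl
      rw [fourierCoeff_eq_inner, pow_one] at this
      exact this
    intro x hx
    rw [fourierCoeff_eq_inner]
    exact hle hx
  have hG0 : fourierCoeff G 0 = fourierCoeff F 0 := by
    have h1 := hcoeffN _ (N.starProjection_apply_mem F)
    rw [fourierCoeff_eq_inner] at h1 ⊢
    rw [hGdef, inner_sub_right, h1, sub_zero, fourierCoeff_eq_inner]
  have hGpos : 0 < ‖G‖ := by
    rw [norm_pos_iff]
    intro h
    have h1 : ‖fourierCoeff G 0‖ = 0 := by rw [h, fourierCoeff_eq_inner]; simp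
    rw [hG0, h0] at h1
    exact (Real.exp_pos _).ne' h1
  obtain ⟨u, hu⟩ := exists_conj_Linf hGconst
  have hE : mulL u F =ᵐ[𝔪] fun t => conj (G t) * F t := by
    filter_upwards [mulL_coeFn u F, hu] with t h1 h2
    rw [h1, h2]
  -- The coefficient of `conj G · F` at `-k` is the inner product of `G` with `z^k F`, which lies in
  -- `N` for `k ≥ 1`.
  have hEmem : mulL u F ∈ H2 := by
    intro n hn
    obtain ⟨k, rfl⟩ : ∃ k : ℕ, n = -(k : ℤ) := ⟨n.natAbs, by omega⟩
    have h1 : fourierCoeff (mulL u F) (-(k : ℤ)) = ⟪G, mulL (polyInf (Polynomial.X ^ k)) F⟫_ℂ := by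
      rw [inner_eq_integral, fourierCoeff]
      refine integral_congr_ae ?_
      filter_upwards [hE, mulL_poly_coeFn (Polynomial.X ^ k) F] with t h1 h2
      rw [h1, h2, neg_neg, Polynomial.eval_pow, Polynomial.eval_X, zeta_pow, smul_eq_mul]
      ring
    rw [h1, ← inner_conj_symm, hGN _ (hshift k (by omega) F (mem_cyc_self F)), map_zero]
  have hE0 : fourierCoeff (mulL u F) 0 = ‖G‖ ^ 2 := by
    have h1 : fourierCoeff (mulL u F) 0 = ⟪G, F⟫_ℂ := by
      rw [inner_eq_integral, fourierCoeff]
      refine integral_congr_ae ?_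
      filter_upwards [hE] with t h1
      rw [h1]; simp
    have h2 : F = G + N.starProjection F := by simp [hGdef]
    rw [h1, h2, inner_add_right, ← inner_conj_symm G (N.starProjection F),
      hGN _ (N.starProjection_apply_mem F), inner_self_eq_norm_sq_to_K]
    simp
  have hEnorm : ∀ᵐ t ∂𝔪, Real.log ‖mulL u F t‖ = Real.log ‖G‖ + Real.log ‖F t‖ := by
    filter_upwards [hE, hGconst, hne] with t h1 h2 h3
    rw [h1, norm_mul, RCLike.norm_conj, h2, Real.log_mul hGpos.ne' (norm_ne_zero_iff.2 h3)]
  have hEint : Integrable (fun t => Real.log ‖mulL u F t‖) 𝔪 :=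
    ((integrable_const (Real.log ‖G‖)).add hlog).congr (hEnorm.mono fun t ht => ht.symm)
  have hEne : ∀ᵐ t ∂𝔪, mulL u F t ≠ 0 := by
    filter_upwards [hE, hGconst, hne] with t h1 h2 h3
    rw [h1, ← norm_ne_zero_iff, norm_mul, RCLike.norm_conj, h2]
    exact mul_ne_zero hGpos.ne' (norm_ne_zero_iff.2 h3)
  -- Jensen for `conj G · F` reads `‖G‖² ≤ ‖G‖ exp ∫ log |F| = ‖G‖ |F(0)|`. As `F(0) = G(0)`, this
  -- gives `‖G‖ ≤ |G(0)|`, which forces all other Fourier coefficients of `G` to vanish.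
  have hJ := norm_fourierCoeff_zero_le hEmem hEne hEint
  rw [integral_congr_ae hEnorm, integral_add (integrable_const _) hlog, Real.exp_add, ← h0, hE0]
    at hJ
  simp only [integral_const, probReal_univ, one_smul, Real.exp_log hGpos, norm_pow,
    Complex.norm_real, norm_norm] at hJ
  have hle : ‖G‖ ≤ ‖fourierCoeff F 0‖ := by
    rw [sq] at hJ; exact le_of_mul_le_mul_left hJ hGpos
  rw [← hG0, fourierCoeff_eq_inner] at hle
  have he : ‖(fourierLp 2 0 : L2T)‖ = 1 := orthonormal_fourier.1 0
  set c := ⟪(fourierLp 2 0 : L2T), G⟫_ℂ with hc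
  have hc0 : c ≠ 0 := norm_pos_iff.1 (hGpos.trans_le hle)
  have hGc : G = c • (fourierLp 2 0 : L2T) := by
    rw [← sub_eq_zero, ← norm_eq_zero, ← sq_eq_zero_iff]
    refine le_antisymm ?_ (sq_nonneg _)
    rw [@norm_sub_sq ℂ, inner_smul_right, ← inner_conj_symm, ← hc, norm_smul, he, mul_one,
      Complex.mul_conj, Complex.normSq_eq_norm_sq]
    simp only [RCLike.re_to_complex, Complex.ofReal_re]
    have := pow_le_pow_left₀ hGpos.le hle 2
    linarith
  have h1 : (polyL2 1 : L2T) = c⁻¹ • G := by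
    rw [hGc, smul_smul, inv_mul_cancel₀ hc0, one_smul, one_eq_fourierLp]
  rw [h1]
  exact (cyc F).smul_mem _ hGF

theorem evalDisc_zero (f : UCircle → ℂ) : evalDisc f 0 = fourierCoeff f 0 := by
  rw [evalDisc, tsum_eq_single 0 (fun n hn => by simp [hn])]
  simp

/-- An outer function in `H²` is cyclic. -/
theorem IsOuter.one_mem_cyc {f : UCircle → ℂ} (hf : IsOuter f) {F : L2T} (hF : F =ᵐ[𝔪] f) :
    polyL2 1 ∈ cyc F := by
  obtain ⟨-, hcoeff, hne, hlog, c, hc, hval⟩ := hf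
  have hlogeq : (fun t => Real.log ‖F t‖) =ᵐ[𝔪] fun t => Real.log ‖f t‖ := by
    filter_upwards [hF] with t ht
    rw [ht]
  refine one_mem_cyc_of_norm_fourierCoeff ?_ ?_ (hlog.congr hlogeq.symm) ?_
  · intro n hn
    rw [fourierCoeff_congr_ae hF]; exact hcoeff n hn
  · filter_upwards [hF, hne] with t h1 h2
    rwa [h1]
  -- Only the value at the origin of the exponential formula is needed, where the kernel is `1`.
  · have h := hval 0 (by simp)
    have h2 : ∀ t, (zeta t + 0) / (zeta t - 0) * (Real.log ‖f t‖ : ℂ) = (Real.log ‖f t‖ : ℂ) := by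
      intro t
      rw [add_zero, sub_zero, div_self (zeta_ne_zero t), one_mul]
    simp only [h2] at h
    rw [evalDisc_zero, integral_complex_ofReal, ← Complex.ofReal_exp] at h
    rw [fourierCoeff_congr_ae hF, h, integral_congr_ae hlogeq, norm_mul, hc, one_mul,
      Complex.norm_real, Real.norm_eq_abs, abs_of_pos (Real.exp_pos _)]

/-! ### Polynomials and cyclic vectors -/

theorem polyL2_add (P Q : Polynomial ℂ) : polyL2 (P + Q) = polyL2 P + polyL2 Q := by
  rw [← mulL_poly_polyL2_one, ← mulL_poly_polyL2_one P, ← mulL_poly_polyL2_one Q]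
  exact map_add (polyMul (polyL2 1)) P Q

theorem polyL2_monomial (n : ℕ) (c : ℂ) :
    polyL2 (Polynomial.monomial n c) = c • polyL2 (Polynomial.X ^ n) := by
  rw [← mulL_poly_polyL2_one, ← mulL_poly_polyL2_one (Polynomial.X ^ n),
    ← Polynomial.smul_X_eq_monomial]
  exact map_smul (polyMul (polyL2 1)) c (Polynomial.X ^ n)

theorem inner_X_pow_polyL2 (n : ℕ) (P : Polynomial ℂ) :
    ⟪polyL2 (Polynomial.X ^ n), polyL2 P⟫_ℂ = P.coeff n := by
  induction P using Polynomial.induction_on' with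
  | add P Q h1 h2 => rw [polyL2_add, inner_add_right, h1, h2, Polynomial.coeff_add]
  | monomial k c =>
    rw [polyL2_monomial, inner_smul_right, polyL2_X_pow, polyL2_X_pow,
      orthonormal_iff_ite.1 (orthonormal_fourier (T := 2 * Real.pi)), Polynomial.coeff_monomial]
    simp [eq_comm]

theorem fourierCoeff_polyL2_nat (P : Polynomial ℂ) (n : ℕ) :
    fourierCoeff (polyL2 P) n = P.coeff n := by
  rw [fourierCoeff_eq_inner, ← polyL2_X_pow, inner_X_pow_polyL2]

theorem inner_X_pow_mul_polyL2 {k : ℕ} {P : Polynomial ℂ} (hP : P.natDegree < k)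
    (Q : Polynomial ℂ) : ⟪polyL2 (Polynomial.X ^ k * Q), polyL2 P⟫_ℂ = 0 := by
  induction Q using Polynomial.induction_on' with
  | add Q₁ Q₂ h1 h2 => rw [mul_add, polyL2_add, inner_add_left, h1, h2, add_zero]
  | monomial n c =>
    rw [← Polynomial.smul_X_eq_monomial, mul_smul_comm, ← pow_add,
      Polynomial.smul_X_eq_monomial, polyL2_monomial, inner_smul_left, inner_X_pow_polyL2,
      Polynomial.coeff_eq_zero_of_natDegree_lt (by omega), mul_zero]

theorem ext_fourierCoeff {f g : L2T} (h : ∀ n : ℤ, fourierCoeff f n = fourierCoeff g n) :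
    f = g := by
  apply fourierBasis.repr.injective
  ext n
  rw [fourierBasis_repr, fourierBasis_repr, h]

theorem exists_polyL2_eq {f : L2T} (hf : f ∈ H2) {m : ℕ}
    (h : ∀ n : ℕ, m < n → fourierCoeff f n = 0) :
    ∃ R : Polynomial ℂ, R.natDegree ≤ m ∧ f = polyL2 R := by
  refine ⟨∑ n ∈ Finset.range (m + 1), Polynomial.monomial n (fourierCoeff f n), ?_, ?_⟩
  · refine Polynomial.natDegree_sum_le_of_forall_le _ _ fun n hn => ?_
    exact (Polynomial.natDegree_monomial_le _).trans (by simpa [Nat.lt_succ_iff] using hn)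
  · refine ext_fourierCoeff fun n => ?_
    rcases lt_or_ge n 0 with hn | hn
    · rw [hf n hn, polyL2_mem_H2 _ n hn]
    · lift n to ℕ using hn
      rw [fourierCoeff_polyL2_nat, Polynomial.finsetSum_coeff]
      simp only [Polynomial.coeff_monomial, Finset.sum_ite_eq', Finset.mem_range]
      split_ifs with hnm
      · rfl
      · exact h n (by omega)

theorem one_mem_cyc_mulL {ψ : LinfT} {F : L2T} (hF : polyL2 1 ∈ cyc F)
    (hψ : polyL2 1 ∈ cyc (mulL ψ (polyL2 1))) : polyL2 1 ∈ cyc (mulL ψ F) :=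
  cyc_le_cyc (mulL_mem_cyc_mulL ψ hF) hψ

/-- Let `G` be the component of `1` orthogonal to the cyclic subspace. Orthogonality to `z^k (1 - c
z)` gives consecutive coefficients of `G` equal moduli, and square summability makes them all zero.
-/
theorem one_mem_cyc_one_sub {c : ℂ} (hc : ‖c‖ = 1) :
    polyL2 1 ∈ cyc (polyL2 (1 - Polynomial.C c * Polynomial.X)) := by
  set F := polyL2 (1 - Polynomial.C c * Polynomial.X) with hF
  set N := cyc F with hN
  have : CompleteSpace N := (isClosed_cyc _).completeSpace_coe
  set G := polyL2 1 - N.starProjection (polyL2 1) with hG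
  have hGorth : G ∈ Nᗮ := N.sub_starProjection_mem_orthogonal _
  have hGH : G ∈ H2 := H2.sub_mem one_mem_H2
    (cyc_le_H2 (polyL2_mem_H2 _) (N.starProjection_apply_mem _))
  have hrec : ∀ k : ℕ, ‖fourierCoeff G (k : ℤ)‖ = ‖fourierCoeff G ((k + 1 : ℕ) : ℤ)‖ := by
    intro k
    have h1 := N.inner_right_of_mem_orthogonal (mulL_poly_mem_cyc F (Polynomial.X ^ k)) hGorth
    have h2 : Polynomial.X ^ k * (1 - Polynomial.C c * Polynomial.X) =
        Polynomial.X ^ k + Polynomial.monomial (k + 1) (-c) := by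
      rw [← Polynomial.C_mul_X_pow_eq_monomial, Polynomial.C_neg]; ring
    rw [hF, mulL_poly_poly, h2, polyL2_add, polyL2_monomial, inner_add_left, inner_smul_left,
      polyL2_X_pow, polyL2_X_pow, ← fourierCoeff_eq_inner, ← fourierCoeff_eq_inner,
      add_eq_zero_iff_eq_neg, map_neg, neg_mul, neg_neg] at h1
    rw [h1, norm_mul, RCLike.norm_conj, hc, one_mul]
  have hconst : ∀ k : ℕ, ‖fourierCoeff G (k : ℤ)‖ = ‖fourierCoeff G ((0 : ℕ) : ℤ)‖ := by
    intro k
    induction k with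
    | zero => rfl
    | succ k ih => rw [← hrec, ih]
  have hlim : Tendsto (fun k : ℕ => ‖fourierCoeff G (k : ℤ)‖ ^ 2) atTop (𝓝 0) :=
    ((hasSum_sq_fourierCoeff G).summable.comp_injective Nat.cast_injective).tendsto_atTop_zero
  simp only [hconst] at hlim
  have hz := tendsto_nhds_unique hlim tendsto_const_nhds
  have hG0 : G = 0 := by
    refine ext_fourierCoeff fun n => ?_
    rw [fourierCoeff_eq_inner 0, inner_zero_right]
    rcases lt_or_ge n 0 with hn | hn
    · exact hGH n hn
    · lift n to ℕ using hn
      rw [← norm_eq_zero, hconst]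
      exact pow_eq_zero_iff two_ne_zero |>.1 hz.symm
  rw [hG, sub_eq_zero] at hG0
  rw [hG0]
  exact N.starProjection_apply_mem _

theorem one_mem_cyc_prod {ι : Type*} (s : Finset ι) (c : ι → ℂ) (hc : ∀ j, ‖c j‖ = 1) :
    polyL2 1 ∈ cyc (polyL2 (∏ j ∈ s, (1 - Polynomial.C (c j) * Polynomial.X))) := by
  classical
  induction s using Finset.induction_on with
  | empty => simpa using mem_cyc_self _
  | insert j s hj ih =>
    rw [Finset.prod_insert hj, ← mulL_poly_poly]
    refine one_mem_cyc_mulL ih ?_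
    rw [mulL_poly_polyL2_one]
    exact one_mem_cyc_one_sub (hc j)

theorem inner_mulL_eq_zero_of_cyc {F G : L2T} {φ : LinfT}
    (h : ∀ P, ⟪G, mulL φ (mulL (polyInf P) F)⟫_ℂ = 0) {x : L2T} (hx : x ∈ cyc F) :
    ⟪G, mulL φ x⟫_ℂ = 0 := by
  have hle : cyc F ≤ LinearMap.ker (innerSL ℂ G ∘L mulL φ).toLinearMap := by
    refine cyc_le_of_forall (innerSL ℂ G ∘L mulL φ).isClosed_ker fun P => ?_
    rw [LinearMap.mem_ker]
    exact h P
  exact hle hx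

/-- If `F` is cyclic and `|F|²` is a trigonometric polynomial of degree at most `m`, then `F` is
orthogonal to `z^{m+1} H²`. -/
theorem inner_X_pow_eq_zero {F : L2T} (hF : polyL2 1 ∈ cyc F) {m : ℕ}
    (h : ∀ k : ℕ, m < k → ⟪F, mulL (polyInf (Polynomial.X ^ k)) F⟫_ℂ = 0) {x : L2T}
    (hx : x ∈ H2) : ⟪F, mulL (polyInf (Polynomial.X ^ (m + 1))) x⟫_ℂ = 0 := by
  -- By cyclicity `x` is a limit of multiples `P F`, and against these only coefficients of `|F|²`
  -- of index above `m` occur.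
  refine inner_mulL_eq_zero_of_cyc (fun P => ?_) (H2_le_cyc hF hx)
  rw [← polyMul_apply F P]
  induction P using Polynomial.induction_on' with
  | add P Q h1 h2 => rw [map_add, map_add, inner_add_right, h1, h2, add_zero]
  | monomial n c =>
    rw [← Polynomial.smul_X_eq_monomial, map_smul, map_smul, inner_smul_right, polyMul_apply,
      ← mulL_poly_mul, ← pow_add, h _ (by omega), mul_zero]

/-- Evaluation at `w` is represented by the Szegő kernel `k = ∑ conj w ^ n z^n`. A zero of `R` at
`w` would make `k` orthogonal to every `P R`, hence to `1`, although `⟪k, 1⟫ = 1`. -/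
theorem eval_ne_zero_of_cyc {R : Polynomial ℂ} (hR : polyL2 1 ∈ cyc (polyL2 R)) {w : ℂ}
    (hw : ‖w‖ < 1) : R.eval w ≠ 0 := by
  intro h0
  have hs : Summable fun n : ℕ => conj w ^ n • polyL2 (Polynomial.X ^ n) := by
    refine Summable.of_norm ?_
    have h1 : ∀ n : ℕ, ‖conj w ^ n • polyL2 (Polynomial.X ^ n)‖ = ‖w‖ ^ n := by
      intro n
      have h2 : ‖(fourierLp 2 n : L2T)‖ = 1 := orthonormal_fourier.1 n
      rw [norm_smul, norm_pow, RCLike.norm_conj, polyL2_X_pow, h2, mul_one]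
    simp only [h1]
    exact summable_geometric_of_lt_one (norm_nonneg _) hw
  obtain ⟨k, hk⟩ := hs
  have hkX : ∀ j : ℕ, ⟪k, polyL2 (Polynomial.X ^ j)⟫_ℂ = w ^ j := by
    intro j
    have h1 : HasSum (fun n : ℕ => ⟪polyL2 (Polynomial.X ^ j),
        conj w ^ n • polyL2 (Polynomial.X ^ n)⟫_ℂ) ⟪polyL2 (Polynomial.X ^ j), k⟫_ℂ :=
      hk.mapL (innerSL ℂ (polyL2 (Polynomial.X ^ j)))
    have h2 := hasSum_single (f := fun n : ℕ => ⟪polyL2 (Polynomial.X ^ j),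
        conj w ^ n • polyL2 (Polynomial.X ^ n)⟫_ℂ) j (fun n hn => by
      rw [inner_smul_right, inner_X_pow_polyL2, Polynomial.coeff_X_pow, if_neg hn.symm, mul_zero])
    rw [← inner_conj_symm, h1.unique h2, inner_smul_right, inner_X_pow_polyL2]
    simp
  have hkP : ∀ P : Polynomial ℂ, ⟪k, polyL2 P⟫_ℂ = P.eval w := by
    intro P
    induction P using Polynomial.induction_on' with
    | add P Q h1 h2 => rw [polyL2_add, inner_add_right, h1, h2, Polynomial.eval_add]
    | monomial n c => rw [polyL2_monomial, inner_smul_right, hkX, Polynomial.eval_monomial]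
  have h1 : ⟪k, mulL (polyInf 1) (polyL2 1)⟫_ℂ = 0 := by
    refine inner_mulL_eq_zero_of_cyc (fun P => ?_) hR
    rw [mulL_poly_one, mulL_poly_poly, hkP, Polynomial.eval_mul, h0, mul_zero]
  rw [mulL_poly_one, hkP, Polynomial.eval_one] at h1
  exact one_ne_zero h1

theorem exists_prod_eq (m : ℕ) : ∀ R : Polynomial ℂ, R.natDegree ≤ m →
    (∀ w : ℂ, ‖w‖ ≤ 1 → R.eval w ≠ 0) → ∃ (c : ℂ) (α : Fin m → ℂ), c ≠ 0 ∧ (∀ j, ‖α j‖ < 1) ∧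
      R = Polynomial.C c * ∏ j, (1 - Polynomial.C (conj (α j)) * Polynomial.X) := by
  induction m with
  | zero =>
    intro R hR h
    rw [Polynomial.eq_C_of_natDegree_le_zero hR] at h ⊢
    exact ⟨R.coeff 0, Fin.elim0, by simpa using h 0 (by simp), fun j => j.elim0, by simp⟩
  | succ m ih =>
    intro R hR h
    rcases Nat.lt_or_ge R.natDegree (m + 1) with hlt | hge
    · obtain ⟨c, α, hc, hα, hRα⟩ := ih R (by omega) h
      -- A missing degree is filled with `α = 0`, whose factor is `1`; the Blaschke product thus
      -- gets exactly `m` factors.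
      refine ⟨c, Fin.cons 0 α, hc, Fin.cases (by simp) (by simpa using hα), ?_⟩
      rw [Fin.prod_univ_succ]
      simpa using hRα
    · obtain ⟨ρ, hρ⟩ := Complex.exists_root (f := R)
        (Polynomial.natDegree_pos_iff_degree_pos.1 (by omega))
      have hρ1 : 1 < ‖ρ‖ := by
        by_contra! hle
        exact h ρ hle hρ
      have hρ0 : ρ ≠ 0 := by
        rintro rfl; simp at hρ1; linarith
      obtain ⟨Q, hQ⟩ := Polynomial.dvd_iff_isRoot.2 hρ
      have hQ0 : Q ≠ 0 := by
        rintro rfl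
        exact h 0 (by simp) (by simp [hQ])
      have hdeg : R.natDegree = 1 + Q.natDegree := by
        rw [hQ, Polynomial.natDegree_mul (Polynomial.X_sub_C_ne_zero ρ) hQ0,
          Polynomial.natDegree_X_sub_C]
      obtain ⟨c, α, hc, hα, hRα⟩ := ih Q (by omega) fun w hw hw0 => h w hw (by simp [hQ, hw0])
      refine ⟨-ρ * c, Fin.cons (conj ρ⁻¹) α, by simp [hρ0, hc], fun j => ?_, ?_⟩
      · refine Fin.cases ?_ (fun j => by simpa using hα j) j
        simpa using inv_lt_one_of_one_lt₀ hρ1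
      · rw [Fin.prod_univ_succ, hQ]
        conv_lhs => rw [hRα]
        simp only [Fin.cons_zero, Fin.cons_succ, Complex.conj_conj, Polynomial.C_mul,
          Polynomial.C_neg]
        have h1 : Polynomial.C ρ * Polynomial.C ρ⁻¹ = 1 := by
          rw [← Polynomial.C_mul, mul_inv_cancel₀ hρ0, Polynomial.C_1]
        linear_combination (-Polynomial.X * Polynomial.C c *
          ∏ j, (1 - Polynomial.C (conj (α j)) * Polynomial.X)) * h1

/-! ### Blaschke products and model spaces -/

theorem one_sub_conj_mul_zeta_ne_zero {α : ℂ} (hα : ‖α‖ < 1) (t : UCircle) :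
    1 - conj α * zeta t ≠ 0 := by
  intro h
  have h1 : ‖conj α * zeta t‖ = 1 := by rw [← sub_eq_zero.1 h, norm_one]
  rw [norm_mul, RCLike.norm_conj, norm_zeta, mul_one] at h1
  exact hα.ne h1

theorem exists_blaschke {m : ℕ} {α : Fin m → ℂ} (hα : ∀ j, ‖α j‖ < 1) :
    ∃ B : LinfT, IsFiniteBlaschke m B ∧
      ∀ᵐ t ∂𝔪, B t = ∏ j, (zeta t - α j) / (1 - conj (α j) * zeta t) := by
  let β : C(UCircle, ℂ) := ⟨fun t => ∏ j, (zeta t - α j) / (1 - conj (α j) * zeta t), by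
    have := continuous_zeta
    refine continuous_finsetProd _ fun j _ => ?_
    exact Continuous.div (by fun_prop) (by fun_prop) (one_sub_conj_mul_zeta_ne_zero (hα j))⟩
  have h : ∀ᵐ t ∂𝔪, contInf β t = ∏ j, (zeta t - α j) / (1 - conj (α j) * zeta t) :=
    contInf_coeFn β
  refine ⟨contInf β, ⟨1, α, by simp, hα, ?_⟩, h⟩
  simpa using h

/-- On the circle `z - α = z · conj (1 - conj α z)`, so the denominators of the Blaschke product
cancel against `R`. -/
theorem blaschke_mul_eval {m : ℕ} {α : Fin m → ℂ} (hα : ∀ j, ‖α j‖ < 1) (c : ℂ)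
    {R : Polynomial ℂ} (hR : R = Polynomial.C c *
      ∏ j, (1 - Polynomial.C (conj (α j)) * Polynomial.X)) (t : UCircle) :
    conj c * ((∏ j, (zeta t - α j) / (1 - conj (α j) * zeta t)) * R.eval (zeta t)) =
      c * zeta t ^ m * conj (R.eval (zeta t)) := by
  have h1 : R.eval (zeta t) = c * ∏ j, (1 - conj (α j) * zeta t) := by
    rw [hR, Polynomial.eval_mul, Polynomial.eval_C, Polynomial.eval_prod]; simp
  have h2 : ∏ j, (zeta t - α j) = zeta t ^ m * conj (∏ j, (1 - conj (α j) * zeta t)) := by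
    have : zeta t ^ m = ∏ _j : Fin m, zeta t := by simp
    rw [this, map_prod, ← Finset.prod_mul_distrib]
    refine Finset.prod_congr rfl fun j _ => ?_
    simp only [map_sub, map_one, map_mul, Complex.conj_conj]
    linear_combination α j * zeta_mul_conj t
  have h3 : ∏ j, (1 - conj (α j) * zeta t) ≠ 0 :=
    Finset.prod_ne_zero_iff.2 fun j _ => one_sub_conj_mul_zeta_ne_zero (hα j) t
  rw [Finset.prod_div_distrib, h2, h1, map_mul]
  generalize ∏ j, (1 - conj (α j) * zeta t) = π at h3 ⊢
  field_simp

/-- The inner product of `H²`, as the one that the general lemmas on inner products refer to. -/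
instance innerH2 : Inner ℂ H2 := InnerProductSpace.toInner

theorem inner_toeplitz_left (φ : LinfT) (f g : H2) :
    ⟪toeplitz φ f, g⟫_ℂ = ⟪mulL φ (f : L2T), (g : L2T)⟫_ℂ := by
  rw [toeplitz]
  simp only [ContinuousLinearMap.comp_apply, Submodule.subtypeL_apply]
  exact Submodule.inner_orthogonalProjectionOnto_eq_of_mem_right _ _

/-- Since `R` is cyclic, it suffices to test against `z B R P`. There `B R = (c / conj c) z^m conj
R`, and `conj R` moves to the other side of the inner product as multiplication of `h₀` by `R`. -/
theorem mem_modelSpace {m : ℕ} {α : Fin m → ℂ} (hα : ∀ j, ‖α j‖ < 1) {c : ℂ} (hc : c ≠ 0)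
    {R : Polynomial ℂ} (hR : R = Polynomial.C c *
      ∏ j, (1 - Polynomial.C (conj (α j)) * Polynomial.X))
    (hcyc : polyL2 1 ∈ cyc (polyL2 R)) {B : LinfT}
    (hB : ∀ᵐ t ∂𝔪, B t = ∏ j, (zeta t - α j) / (1 - conj (α j) * zeta t)) {h₀ : H2}
    (horth : ∀ x ∈ H2, ⟪mulL (polyInf R) (h₀ : L2T),
      mulL (polyInf (Polynomial.X ^ (m + 1))) x⟫_ℂ = 0) :
    h₀ ∈ modelSpace (zInf • B : LinfT) := by
  rw [modelSpace, Submodule.mem_orthogonal']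
  rintro _ ⟨g, rfl⟩
  rw [← inner_conj_symm]
  change conj ⟪toeplitz (zInf • B : LinfT) g, h₀⟫_ℂ = 0
  rw [inner_toeplitz_left, inner_conj_symm]
  refine inner_mulL_eq_zero_of_cyc (fun P => ?_) (H2_le_cyc hcyc g.2)
  have h1 := horth _ (polyL2_mem_H2 P)
  have h2 : ⟪(h₀ : L2T), mulL (zInf • B : LinfT) (mulL (polyInf P) (polyL2 R))⟫_ℂ =
      c / conj c * ⟪mulL (polyInf R) (h₀ : L2T),
        mulL (polyInf (Polynomial.X ^ (m + 1))) (polyL2 P)⟫_ℂ := by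
    rw [inner_eq_integral, inner_eq_integral, ← integral_const_mul]
    refine integral_congr_ae ?_
    filter_upwards [mulL_coeFn (zInf • B : LinfT) (mulL (polyInf P) (polyL2 R)),
      mulL_poly_coeFn P (polyL2 R), polyL2_coeFn R, mulL_poly_coeFn R (h₀ : L2T),
      mulL_poly_coeFn (Polynomial.X ^ (m + 1)) (polyL2 P), polyL2_coeFn P, hB,
      Lp.coeFn_lpSMul (r := ∞) zInf B, coeFn_fourierLp (T := 2 * Real.pi) ∞ 1]
      with t e1 e2 e3 e4 e5 e6 e7 e8 e9
    have hz : zInf t = zeta t := e9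
    rw [e1, e8, Pi.smul_apply', e2, e3, e4, e5, e6, e7, hz, smul_eq_mul, map_mul,
      Polynomial.eval_pow, Polynomial.eval_X]
    have hcc : conj c ≠ 0 := by simpa using hc
    have key := blaschke_mul_eval hα c hR t
    have key2 : (∏ j, (zeta t - α j) / (1 - conj (α j) * zeta t)) * R.eval (zeta t) =
        c / conj c * (zeta t ^ m * conj (R.eval (zeta t))) := by
      generalize (∏ j, (zeta t - α j) / (1 - conj (α j) * zeta t)) = π at key ⊢
      field_simp
      linear_combination key
    linear_combination (conj ((h₀ : L2T) t) * zeta t * P.eval (zeta t)) * key2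
  rw [h2, h1, mul_zero]

/-! ### The common denominator of a rational pair -/

theorem exists_zeta_eq {w : ℂ} (hw : ‖w‖ = 1) : ∃ t : UCircle, zeta t = w := by
  refine ⟨(Complex.arg w : ℝ), ?_⟩
  rw [zeta_coe, circleMap]
  have := Complex.norm_mul_exp_arg_mul_I w
  rw [hw] at this
  simpa using this

theorem eq_of_ae_eq_circle {f g : UCircle → ℝ} (hf : Continuous f) (hg : Continuous g)
    (h : f =ᵐ[𝔪] g) : f = g := by
  have h2 : f =ᵐ[volume] g := by
    rw [volume_eq_smul_haarAddCircle]
    exact Measure.ae_smul_measure h _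
  exact (hf.ae_eq_iff_eq volume hg).1 h2

theorem continuous_norm_eval_zeta (P : Polynomial ℂ) :
    Continuous fun t : UCircle => ‖P.eval (zeta t)‖ := (polyC P).continuous.norm

/-- The function is `r = q/a`. Dividing `|a|² + |b|² = 1` by `|a|²` gives `|r|² = |p|² + |q|²`,
which is bounded. -/
theorem exists_Linf_quotient {p q : Polynomial ℂ} {a b : LinfT}
    (ha : ∀ᵐ t ∂𝔪, a t ≠ 0) (hq : ∀ᵐ t ∂𝔪, q.eval (zeta t) ≠ 0)
    (hsq : ∀ᵐ t ∂𝔪, ‖a t‖ ^ 2 + ‖b t‖ ^ 2 = 1)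
    (hφ : ∀ᵐ t ∂𝔪, b t / a t = p.eval (zeta t) / q.eval (zeta t)) :
    ∃ r : LinfT, ∀ᵐ t ∂𝔪, r t * a t = q.eval (zeta t) ∧ r t * b t = p.eval (zeta t) ∧
      ‖r t‖ ^ 2 = ‖p.eval (zeta t)‖ ^ 2 + ‖q.eval (zeta t)‖ ^ 2 := by
  have hall : ∀ᵐ t ∂𝔪, q.eval (zeta t) / a t * a t = q.eval (zeta t) ∧
      q.eval (zeta t) / a t * b t = p.eval (zeta t) ∧
      ‖q.eval (zeta t) / a t‖ ^ 2 = ‖p.eval (zeta t)‖ ^ 2 + ‖q.eval (zeta t)‖ ^ 2 := by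
    filter_upwards [ha, hq, hsq, hφ] with t h1 h2 h3 h4
    have h5 : q.eval (zeta t) / a t * b t = p.eval (zeta t) := by
      rw [div_eq_div_iff h1 h2] at h4
      field_simp
      linear_combination h4
    refine ⟨div_mul_cancel₀ _ h1, h5, ?_⟩
    have h6 : ‖a t‖ ≠ 0 := norm_ne_zero_iff.2 h1
    rw [← h5, norm_mul, norm_div]
    field_simp
    linear_combination -h3
  obtain ⟨C, hC⟩ := isCompact_univ.exists_bound_of_continuousOn
    (f := fun t : UCircle => ‖p.eval (zeta t)‖ ^ 2 + ‖q.eval (zeta t)‖ ^ 2)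
    (((continuous_norm_eval_zeta p).pow 2).add ((continuous_norm_eval_zeta q).pow 2)).continuousOn
  have hmem : MemLp (fun t => q.eval (zeta t) / a t) ∞ 𝔪 := by
    refine memLp_top_of_bound ?_ (Real.sqrt C) ?_
    · exact ((polyC q).continuous.aestronglyMeasurable.aemeasurable.div
        (Lp.aestronglyMeasurable a).aemeasurable).aestronglyMeasurable
    · filter_upwards [hall] with t ht
      refine Real.le_sqrt_of_sq_le ?_
      rw [ht.2.2]
      exact (le_abs_self _).trans (hC t (Set.mem_univ _))
  refine ⟨hmem.toLp, ?_⟩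
  filter_upwards [hmem.coeFn_toLp, hall] with t h1 h2
  rw [h1]
  exact h2

theorem mul_norm_sq (z : ℂ) : conj z * z = ((‖z‖ ^ 2 : ℝ) : ℂ) := by
  rw [Complex.conj_mul']; simp

/-- A rational pair has a common denominator `R` that is a polynomial without zeros in the closed
disc. -/
theorem exists_denominator {m : ℕ} {p q : Polynomial ℂ} (hp : p.natDegree ≤ m)
    (hqdeg : q.natDegree ≤ m) (hqcyc : polyL2 1 ∈ cyc (polyL2 q))
    (hq : ∀ᵐ t ∂𝔪, q.eval (zeta t) ≠ 0)
    (hcop : ∀ w : ℂ, ‖w‖ = 1 → q.eval w = 0 → p.eval w ≠ 0) {a b : LinfT} (hpair : IsPair b a)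
    (hφ : ∀ᵐ t ∂𝔪, b t / a t = p.eval (zeta t) / q.eval (zeta t)) :
    ∃ R : Polynomial ℂ, R.natDegree ≤ m ∧ polyL2 1 ∈ cyc (polyL2 R) ∧
      (∀ w : ℂ, ‖w‖ ≤ 1 → R.eval w ≠ 0) ∧
      (∀ t, ‖R.eval (zeta t)‖ ^ 2 = ‖p.eval (zeta t)‖ ^ 2 + ‖q.eval (zeta t)‖ ^ 2) ∧
      ∀ᵐ t ∂𝔪, R.eval (zeta t) * a t = q.eval (zeta t) ∧
        R.eval (zeta t) * b t = p.eval (zeta t) := by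
  obtain ⟨-, -, haH, hout, -, hsq⟩ := hpair
  obtain ⟨r, hr⟩ := exists_Linf_quotient hout.2.2.1 hq hsq hφ
  set F := mulL r (polyL2 1) with hF
  set A := mulL a (polyL2 1) with hA
  have hAcyc : polyL2 1 ∈ cyc A := hout.one_mem_cyc (mulL_one_coeFn a)
  have hrA : mulL r A = polyL2 q := by
    rw [mulL_eq_iff]
    filter_upwards [hr, mulL_one_coeFn a, polyL2_coeFn q] with t h1 h2 h3
    rw [h2, h3, h1.1]
  -- Because `a` is outer, `1` is a limit of multiples `P a`; multiplying by `r` makes `r` a limit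
  -- of the polynomials `P q`.
  have hFH : F ∈ H2 := by
    have h1 := mulL_mem_cyc_mulL r hAcyc
    rw [hrA] at h1
    exact cyc_le_H2 (polyL2_mem_H2 q) h1
  -- Conversely `q = r a` lies in the cyclic subspace of `r`, and `q` is cyclic.
  have hFcyc : polyL2 1 ∈ cyc F := by
    have h1 : A ∈ cyc (polyL2 1) := H2_eq_cyc_one ▸ mulL_one_mem_H2 haH
    have h2 := mulL_mem_cyc_mulL r h1
    rw [hrA] at h2
    exact cyc_le_cyc h2 hqcyc
  have hFtrig : ∀ k : ℕ, m < k → ⟪F, mulL (polyInf (Polynomial.X ^ k)) F⟫_ℂ = 0 := by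
    intro k hk
    have h1 := inner_X_pow_mul_polyL2 (hp.trans_lt hk) p
    have h2 := inner_X_pow_mul_polyL2 (hqdeg.trans_lt hk) q
    rw [← inner_conj_symm, map_eq_zero] at h1 h2
    have h3 : ⟪F, mulL (polyInf (Polynomial.X ^ k)) F⟫_ℂ =
        ⟪polyL2 p, polyL2 (Polynomial.X ^ k * p)⟫_ℂ +
        ⟪polyL2 q, polyL2 (Polynomial.X ^ k * q)⟫_ℂ := by
      rw [inner_eq_integral, inner_eq_integral, inner_eq_integral,
        ← integral_add (integrable_conj_mul _ _) (integrable_conj_mul _ _)]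
      refine integral_congr_ae ?_
      filter_upwards [mulL_poly_coeFn (Polynomial.X ^ k) F, mulL_one_coeFn r, polyL2_coeFn p,
        polyL2_coeFn q, polyL2_coeFn (Polynomial.X ^ k * p), polyL2_coeFn (Polynomial.X ^ k * q),
        hr] with t e1 e2 e3 e4 e5 e6 e7
      have e8 := e7.2.2
      have e9 : conj (r t) * r t = conj (p.eval (zeta t)) * p.eval (zeta t) +
          conj (q.eval (zeta t)) * q.eval (zeta t) := by
        rw [mul_norm_sq, mul_norm_sq, mul_norm_sq, e8, Complex.ofReal_add]
      rw [e1, e2, e3, e4, e5, e6, Polynomial.eval_mul, Polynomial.eval_mul]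
      linear_combination (Polynomial.X ^ k : Polynomial ℂ).eval (zeta t) * e9
    rw [h3, h1, h2, add_zero]
  -- Here `|r|² = |p|² + |q|²` has trigonometric degree at most `m`, so the cyclic function `r` is
  -- orthogonal to `z^(m+1) H²`: it is a polynomial.
  obtain ⟨R, hRdeg, hR⟩ := exists_polyL2_eq hFH (m := m) fun n hn => by
    obtain ⟨j, rfl⟩ := Nat.exists_eq_add_of_lt hn
    have h1 := inner_X_pow_eq_zero hFcyc hFtrig (polyL2_mem_H2 (Polynomial.X ^ j))
    rw [mulL_poly_poly, ← pow_add, ← inner_conj_symm, map_eq_zero, polyL2_X_pow,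
      ← fourierCoeff_eq_inner] at h1
    rw [← h1]
    congr 2
    ring
  have hRr : ∀ᵐ t ∂𝔪, R.eval (zeta t) = r t := by
    have h1 : polyL2 R =ᵐ[𝔪] F := by rw [hR]
    filter_upwards [polyL2_coeFn R, h1, mulL_one_coeFn r] with t e1 e2 e3
    rw [← e1, e2, e3]
  have hnorm : ∀ t, ‖R.eval (zeta t)‖ ^ 2 = ‖p.eval (zeta t)‖ ^ 2 + ‖q.eval (zeta t)‖ ^ 2 := by
    refine congrFun (eq_of_ae_eq_circle ((continuous_norm_eval_zeta R).pow 2)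
      (((continuous_norm_eval_zeta p).pow 2).add ((continuous_norm_eval_zeta q).pow 2)) ?_)
    filter_upwards [hRr, hr] with t h1 h2
    simp only [h1]
    exact h2.2.2
  rw [hR] at hFcyc
  refine ⟨R, hRdeg, hFcyc, fun w hw => ?_, hnorm, ?_⟩
  · rcases hw.lt_or_eq with hw | hw
    · exact eval_ne_zero_of_cyc hFcyc hw
    · intro h0
      obtain ⟨t, ht⟩ := exists_zeta_eq hw
      have h1 := hnorm t
      rw [ht, h0, norm_zero] at h1
      have h2 : ‖q.eval w‖ = 0 := by nlinarith [sq_nonneg ‖p.eval w‖, sq_nonneg ‖q.eval w‖]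
      have h3 : ‖p.eval w‖ = 0 := by nlinarith [sq_nonneg ‖p.eval w‖, sq_nonneg ‖q.eval w‖]
      exact hcop w hw (norm_eq_zero.1 h2) (norm_eq_zero.1 h3)
  · filter_upwards [hRr, hr] with t h1 h2
    rw [h1]
    exact ⟨h2.1, h2.2.1⟩

/-! ### Operator ranges -/

section Douglas

theorem opSqrt_mul_self {H : Type*} [NormedAddCommGroup H] [InnerProductSpace ℂ H]
    [CompleteSpace H] {A : H →L[ℂ] H} (hA : 0 ≤ A) : opSqrt A * opSqrt A = A :=
  CFC.sqrt_mul_sqrt_self A hA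

theorem isSelfAdjoint_opSqrt {H : Type*} [NormedAddCommGroup H] [InnerProductSpace ℂ H]
    [CompleteSpace H] (A : H →L[ℂ] H) : IsSelfAdjoint (opSqrt A) :=
  IsSelfAdjoint.of_nonneg (CFC.sqrt_nonneg A)

/-- Equality of norms turns a convergent sequence `U y_n` into a Cauchy sequence `V y_n`. -/
theorem exists_mem_closure_range_prod {H K E : Type*} [NormedAddCommGroup H]
    [InnerProductSpace ℂ H] [NormedAddCommGroup K] [InnerProductSpace ℂ K] [CompleteSpace K]
    [NormedAddCommGroup E] [InnerProductSpace ℂ E]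
    (U : E →L[ℂ] H) (V : E →L[ℂ] K) (hUV : ∀ y, ‖U y‖ = ‖V y‖) {u : H}
    (hu : u ∈ closure (Set.range U)) :
    ∃ v, (u, v) ∈ closure (Set.range fun y => (U y, V y)) := by
  obtain ⟨x, hx, hlim⟩ := mem_closure_iff_seq_limit.1 hu
  choose y hy using hx
  have hc : CauchySeq fun n => V (y n) := by
    have h1 := hlim.cauchySeq
    rw [Metric.cauchySeq_iff'] at h1 ⊢
    intro ε hε
    obtain ⟨N, hN⟩ := h1 ε hε
    refine ⟨N, fun n hn => ?_⟩
    have h2 := hN n hn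
    rwa [dist_eq_norm, ← hy, ← hy, ← map_sub, hUV, map_sub, ← dist_eq_norm] at h2
  obtain ⟨v, hv⟩ := cauchySeq_tendsto_of_complete hc
  refine ⟨v, mem_closure_of_tendsto (hlim.prodMk_nhds hv) (Eventually.of_forall fun n => ?_)⟩
  exact ⟨y n, Prod.ext (hy n) rfl⟩

variable {H K : Type*} [NormedAddCommGroup H] [InnerProductSpace ℂ H] [CompleteSpace H]
  [NormedAddCommGroup K] [InnerProductSpace ℂ K] [CompleteSpace K]

/-- If `D² = A A*` with `D` self-adjoint and `A` injective, then the range space of `D` is the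
range of `A` with the norm transported by `A`. -/
theorem rangeSpace_of_mul_self_eq {D : H →L[ℂ] H} (hD : IsSelfAdjoint D) {A : K →L[ℂ] H}
    {ι : H → K} (hι : ∀ k y, ⟪k, ι y⟫_ℂ = ⟪A k, y⟫_ℂ) (hDA : ∀ y, D (D y) = A (ι y))
    (hA : ∀ k, A k = 0 → k = 0) :
    (∀ k, ∃ f : RangeSpace D, RangeSpace.incl f = A k) ∧
    (∀ f : RangeSpace D, ∃ k, A k = RangeSpace.incl f) ∧
    ∀ (f g : RangeSpace D) (k l : K), RangeSpace.incl f = A k → RangeSpace.incl g = A l →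
      ⟪f, g⟫_ℂ = ⟪k, l⟫_ℂ := by
  have hadj : ∀ y, A.adjoint y = ι y := fun y =>
    ext_inner_left ℂ fun k => by rw [ContinuousLinearMap.adjoint_inner_right, hι]
  have hDs : ∀ x y, ⟪D x, y⟫_ℂ = ⟪x, D y⟫_ℂ := fun x y => by
    rw [← ContinuousLinearMap.adjoint_inner_right,
      ContinuousLinearMap.isSelfAdjoint_iff'.1 hD]
  have hDι : ∀ x y, ⟪D x, D y⟫_ℂ = ⟪A.adjoint x, A.adjoint y⟫_ℂ := fun x y => by
    rw [hDs, hDA, ContinuousLinearMap.adjoint_inner_left, hadj]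
  have hnorm : ∀ y, ‖D y‖ = ‖A.adjoint y‖ := fun y => by
    have h := hDι y y
    rw [inner_self_eq_norm_sq_to_K, inner_self_eq_norm_sq_to_K] at h
    have h2 : ‖D y‖ ^ 2 = ‖A.adjoint y‖ ^ 2 := by exact_mod_cast h
    exact (sq_eq_sq₀ (norm_nonneg _) (norm_nonneg _)).1 h2
  -- `Γ` is the closed graph of the isometric correspondence `D y ↔ A* y`. The relations needed
  -- below hold on the generating pairs and pass to the closure.
  set Γ : Set (H × K) := closure (Set.range fun y => (D y, A.adjoint y)) with hΓ
  have hker : ∀ z ∈ Γ, z.1 ∈ (LinearMap.ker D.toLinearMap)ᗮ := by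
    refine closure_minimal ?_
      ((Submodule.isClosed_orthogonal _).preimage continuous_fst)
    rintro _ ⟨y, rfl⟩
    refine (Submodule.mem_orthogonal _ _).2 fun x hx => ?_
    have hx' : D x = 0 := hx
    change ⟪x, D y⟫_ℂ = 0
    rw [← hDs, hx', inner_zero_left]
  have hmap : ∀ z ∈ Γ, D z.1 = A z.2 := by
    refine closure_minimal ?_ (isClosed_eq (by fun_prop) (by fun_prop))
    rintro _ ⟨y, rfl⟩
    change D (D y) = A (A.adjoint y)
    rw [hDA, hadj]
  have hinner : ∀ w ∈ Γ, ∀ z ∈ Γ, ⟪w.1, z.1⟫_ℂ = ⟪w.2, z.2⟫_ℂ := by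
    intro w hw
    refine closure_minimal ?_ (isClosed_eq (by fun_prop) (by fun_prop))
    rintro _ ⟨y, rfl⟩
    revert w
    refine closure_minimal ?_ (isClosed_eq (by fun_prop) (by fun_prop))
    rintro _ ⟨x, rfl⟩
    exact hDι x y
  -- Injectivity of `A` means that `A*` has dense range.
  have hexK : ∀ k, ∃ x, (x, k) ∈ Γ := by
    intro k
    have hk : k ∈ closure (Set.range A.adjoint) := by
      have h1 : (LinearMap.range A.adjoint.toLinearMap).topologicalClosure = ⊤ := by
        rw [Submodule.topologicalClosure_eq_top_iff, ContinuousLinearMap.orthogonal_range,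
          ContinuousLinearMap.adjoint_adjoint]
        exact LinearMap.ker_eq_bot'.2 hA
      have h2 : k ∈ (LinearMap.range A.adjoint.toLinearMap).topologicalClosure := h1 ▸ trivial
      rw [← SetLike.mem_coe, Submodule.topologicalClosure_coe] at h2
      exact h2
    obtain ⟨x, hx⟩ := exists_mem_closure_range_prod A.adjoint D (fun y => (hnorm y).symm) hk
    refine ⟨x, ?_⟩
    have h3 := map_mem_closure continuous_swap hx (t := Set.range fun y => (D y, A.adjoint y))
      (by rintro _ ⟨y, rfl⟩; exact ⟨y, rfl⟩)
    exact h3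
  refine ⟨fun k => ?_, fun f => ?_, fun f g k l hf hg => ?_⟩
  · obtain ⟨x, hx⟩ := hexK k
    obtain ⟨f, hf⟩ := (RangeSpace.mem_range_iff (A := D) (A k)).1 ⟨x, hmap _ hx⟩
    exact ⟨f, hf⟩
  · have hx : RangeSpace.pre f ∈ closure (Set.range D) := by
      have h1 := RangeSpace.pre_mem f
      have h2 := ContinuousLinearMap.orthogonal_range D
      rw [ContinuousLinearMap.isSelfAdjoint_iff'.1 hD] at h2
      rw [← h2, Submodule.orthogonal_orthogonal_eq_closure, ← SetLike.mem_coe,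
        Submodule.topologicalClosure_coe] at h1
      exact h1
    obtain ⟨k, hk⟩ := exists_mem_closure_range_prod D A.adjoint hnorm hx
    exact ⟨k, by rw [← hmap _ hk, RangeSpace.map_pre]⟩
  · obtain ⟨x, hx⟩ := hexK k
    obtain ⟨y, hy⟩ := hexK l
    have h1 : x = RangeSpace.pre f := RangeSpace.pre_unique (hker _ hx) (by rw [hmap _ hx, hf])
    have h2 : y = RangeSpace.pre g := RangeSpace.pre_unique (hker _ hy) (by rw [hmap _ hy, hg])
    rw [RangeSpace.inner_def, ← h1, ← h2]
    exact hinner _ hx _ hy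

end Douglas

/-! ### The structure of `H(b)` -/

theorem inner_toeplitz_star_right (φ : LinfT) (f g : H2) :
    ⟪f, toeplitz (star φ) g⟫_ℂ = ⟪mulL φ (f : L2T), (g : L2T)⟫_ℂ := by
  rw [inner_mulL_left, ← inner_conj_symm, inner_toeplitz_left, inner_conj_symm]

theorem toeplitz_coe {φ : LinfT} {f : H2} (h : mulL φ (f : L2T) ∈ H2) :
    (toeplitz φ f : L2T) = mulL φ (f : L2T) := by
  rw [toeplitz]
  simp only [ContinuousLinearMap.comp_apply, Submodule.subtypeL_apply]
  exact Submodule.starProjection_eq_self_iff.2 h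

theorem mulL_mem_H2 {φ : LinfT} (h : IsHinf φ) {f : L2T} (hf : f ∈ H2) : mulL φ f ∈ H2 :=
  mulL_mem_H2_of_one (mulL_one_mem_H2 h) hf

theorem zInf_eq : zInf = polyInf Polynomial.X := by
  rw [Lp.ext_iff]
  filter_upwards [coeFn_fourierLp (T := 2 * Real.pi) ∞ 1, polyInf_coeFn Polynomial.X] with t h1 h2
  rw [h2, Polynomial.eval_X]
  exact h1

theorem shift_coe (f : H2) : (shift f : L2T) = mulL (polyInf Polynomial.X) (f : L2T) := by
  rw [shift, zInf_eq]
  exact toeplitz_coe (mulL_poly_mem_H2 _ f.2)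

/-- `IsConjugatePair b a f g` expresses that `T_b̄ f = T_ā g`. -/
def IsConjugatePair (b a : LinfT) (f g : H2) : Prop := toeplitz (star b) f = toeplitz (star a) g

theorem isConjugatePair_iff {b a : LinfT} {f g : H2} : IsConjugatePair b a f g ↔
    ∀ x ∈ H2, ⟪mulL b x, (f : L2T)⟫_ℂ = ⟪mulL a x, (g : L2T)⟫_ℂ := by
  constructor
  · intro h x hx
    have h1 := congrArg (fun y => ⟪(⟨x, hx⟩ : H2), y⟫_ℂ) h
    simpa only [inner_toeplitz_star_right] using h1
  · intro h
    refine ext_inner_left ℂ fun x => ?_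
    rw [inner_toeplitz_star_right, inner_toeplitz_star_right]
    exact h x x.2

theorem inner_mulL_add_inner_mulL {b a : LinfT} (h : ∀ᵐ t ∂𝔪, ‖a t‖ ^ 2 + ‖b t‖ ^ 2 = 1)
    (x y : L2T) : ⟪mulL b x, mulL b y⟫_ℂ + ⟪mulL a x, mulL a y⟫_ℂ = ⟪x, y⟫_ℂ := by
  rw [inner_eq_integral, inner_eq_integral, inner_eq_integral,
    ← integral_add (integrable_conj_mul _ _) (integrable_conj_mul _ _)]
  refine integral_congr_ae ?_
  filter_upwards [h, mulL_coeFn b x, mulL_coeFn b y, mulL_coeFn a x, mulL_coeFn a y]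
    with t h1 h2 h3 h4 h5
  have h6 : conj (a t) * a t + conj (b t) * b t = 1 := by
    rw [mul_norm_sq, mul_norm_sq, ← Complex.ofReal_add, h1, Complex.ofReal_one]
  rw [h2, h3, h4, h5, map_mul, map_mul]
  linear_combination conj (x t) * y t * h6

/-- For analytic symbols `T_b̄ T_b` has symbol `|b|²`, and the two symbols add up to `1`. -/
theorem toeplitz_star_mul_self_add {b a : LinfT} (hab : IsPair b a) (w : H2) :
    toeplitz (star b) (toeplitz b w) + toeplitz (star a) (toeplitz a w) = w := by
  obtain ⟨hb, -, ha, -, -, hsq⟩ := hab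
  refine ext_inner_left ℂ fun v => ?_
  rw [inner_add_right, inner_toeplitz_star_right, inner_toeplitz_star_right,
    toeplitz_coe (mulL_mem_H2 hb w.2), toeplitz_coe (mulL_mem_H2 ha w.2),
    inner_mulL_add_inner_mulL hsq]
  rfl

/-- The hypothesis says that `g` is orthogonal to `a H²`, which is dense because `a` is outer. -/
theorem toeplitz_star_injective {b a : LinfT} (hab : IsPair b a) {g : H2}
    (hg : toeplitz (star a) g = 0) : g = 0 := by
  have hcyc := hab.2.2.2.1.one_mem_cyc (mulL_one_coeFn a)
  have h1 : ⟪(g : L2T), mulL (polyInf 1) (g : L2T)⟫_ℂ = 0 := by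
    refine inner_mulL_eq_zero_of_cyc (fun P => ?_) (H2_le_cyc hcyc g.2)
    rw [mulL_poly_one, mulL_comm, ← inner_conj_symm, mulL_poly_polyL2_one, map_eq_zero,
      ← inner_toeplitz_star_right a ⟨polyL2 P, polyL2_mem_H2 P⟩, hg, inner_zero_right]
  rw [mulL_poly_one, inner_self_eq_zero] at h1
  exact Subtype.ext h1

theorem adjoint_toeplitz (φ : LinfT) :
    ContinuousLinearMap.adjoint (toeplitz φ) = toeplitz (star φ) := by
  symm
  rw [ContinuousLinearMap.eq_adjoint_iff]
  intro x y
  rw [← inner_conj_symm, inner_toeplitz_star_right, inner_conj_symm, ← inner_conj_symm,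
    ← inner_toeplitz_left, inner_conj_symm]

theorem one_sub_toeplitz_nonneg {b a : LinfT} (hab : IsPair b a) :
    0 ≤ 1 - toeplitz b * toeplitz (star b) := by
  rw [ContinuousLinearMap.nonneg_iff_isPositive]
  have hb : ‖toeplitz b‖ ≤ 1 := by
    refine ContinuousLinearMap.opNorm_le_bound _ zero_le_one fun w => ?_
    have h1 := congrArg (fun y => ⟪w, y⟫_ℂ) (toeplitz_star_mul_self_add hab w)
    simp only [inner_add_right] at h1
    rw [← adjoint_toeplitz, ← adjoint_toeplitz, ContinuousLinearMap.adjoint_inner_right,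
      ContinuousLinearMap.adjoint_inner_right, inner_self_eq_norm_sq_to_K,
      inner_self_eq_norm_sq_to_K, inner_self_eq_norm_sq_to_K] at h1
    have h2 : ‖toeplitz b w‖ ^ 2 + ‖toeplitz a w‖ ^ 2 = ‖w‖ ^ 2 := by exact_mod_cast h1
    rw [one_mul]
    exact (sq_le_sq₀ (norm_nonneg _) (norm_nonneg _)).1 (by nlinarith [sq_nonneg ‖toeplitz a w‖])
  have hbs : ‖toeplitz (star b)‖ ≤ 1 := by
    rw [← adjoint_toeplitz, LinearIsometryEquiv.norm_map]; exact hb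
  rw [ContinuousLinearMap.isPositive_def']
  refine ⟨?_, fun x => ?_⟩
  · rw [← adjoint_toeplitz, ← ContinuousLinearMap.star_eq_adjoint]
    exact (IsSelfAdjoint.one _).sub (IsSelfAdjoint.mul_star_self _)
  · rw [ContinuousLinearMap.reApplyInnerSelf_apply, sub_apply, inner_sub_left,
      mul_apply_eq_comp, one_apply_eq_self,
      ← ContinuousLinearMap.adjoint_inner_right, adjoint_toeplitz, map_sub,
      inner_self_eq_norm_sq, inner_self_eq_norm_sq, sub_nonneg]
    have := (toeplitz (star b)).le_of_opNorm_le hbs x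
    rw [one_mul] at this
    exact pow_le_pow_left₀ (norm_nonneg _) this 2

theorem isSelfAdjoint_defect (b : LinfT) : IsSelfAdjoint (defect b) :=
  isSelfAdjoint_opSqrt _

theorem defect_defect {b a : LinfT} (hab : IsPair b a) (y : H2) :
    defect b (defect b y) = y - toeplitz b (toeplitz (star b) y) := by
  have h := opSqrt_mul_self (one_sub_toeplitz_nonneg hab)
  exact congrArg (fun T : H2 →L[ℂ] H2 => T y) h

/-- With `K` the space of pairs satisfying `T* f = U* g` and `A` the first coordinate on `K`, one
has `D² = A A*`. Thus the range space of `D` is `K` itself, and `A` is injective because `U*` is. -/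
theorem rangeSpace_structure {H : Type*} [NormedAddCommGroup H] [InnerProductSpace ℂ H]
    [CompleteSpace H] {T T' U U' D : H →L[ℂ] H} (hT : T.adjoint = T') (hU : U.adjoint = U')
    (hTU : ∀ w, T' (T w) + U' (U w) = w) (hU0 : ∀ g, U' g = 0 → g = 0) (hD : IsSelfAdjoint D)
    (hDD : ∀ y, D (D y) = y - T (T' y)) :
    (∀ f g, T' f = U' g → ∃ F : RangeSpace D, RangeSpace.incl F = f) ∧
    (∀ F : RangeSpace D, ∃ g, T' (RangeSpace.incl F) = U' g) ∧
    ∀ (F F' : RangeSpace D) (g g' : H), T' (RangeSpace.incl F) = U' g →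
      T' (RangeSpace.incl F') = U' g' →
      ⟪F, F'⟫_ℂ = ⟪RangeSpace.incl F, RangeSpace.incl F'⟫_ℂ + ⟪g, g'⟫_ℂ := by
  let L : WithLp 2 (H × H) →L[ℂ] H := T' ∘L WithLp.fstL 2 ℂ H H - U' ∘L WithLp.sndL 2 ℂ H H
  have hL : ∀ k, L k = T' k.fst - U' k.snd := fun k => rfl
  let K : Submodule ℂ (WithLp 2 (H × H)) := LinearMap.ker L.toLinearMap
  have : CompleteSpace K := L.isClosed_ker.completeSpace_coe
  have hK : ∀ f g : H, WithLp.toLp 2 (f, g) ∈ K ↔ T' f = U' g := fun f g => by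
    rw [LinearMap.mem_ker, ContinuousLinearMap.coe_coe, hL, sub_eq_zero]
    exact Iff.rfl
  let A : K →L[ℂ] H := WithLp.fstL 2 ℂ H H ∘L K.subtypeL
  -- This is `A*`. The pair lies in `K` because `T*(1 - T T*) y = (1 - T* T) T* y = U* U T* y`.
  let ι : H → K := fun y => ⟨WithLp.toLp 2 (y - T (T' y), U (T' y)), (hK _ _).2 (by
      rw [map_sub, sub_eq_iff_eq_add, add_comm]
      exact (hTU _).symm)⟩
  obtain ⟨h1, h2, h3⟩ := rangeSpace_of_mul_self_eq hD (A := A) (ι := ι)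
    (fun k y => by
      have hk : T' k.1.fst = U' k.1.snd := (hK k.1.fst k.1.snd).1 k.2
      change ⟪k.1, (ι y).1⟫_ℂ = ⟪k.1.fst, y⟫_ℂ
      rw [WithLp.prod_inner_apply]
      change ⟪k.1.fst, y - T (T' y)⟫_ℂ + ⟪k.1.snd, U (T' y)⟫_ℂ = _
      rw [inner_sub_right, ← ContinuousLinearMap.adjoint_inner_left, hT, hk,
        ← ContinuousLinearMap.adjoint_inner_left U, hU, sub_add_cancel])
    (fun y => hDD y)
    (fun k hk0 => by
      have hk : T' k.1.fst = U' k.1.snd := (hK k.1.fst k.1.snd).1 k.2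
      have hf : k.1.fst = 0 := hk0
      rw [hf, map_zero] at hk
      exact Subtype.ext (WithLp.ofLp_injective 2 (Prod.ext hf (hU0 _ hk.symm))))
  refine ⟨fun f g h => h1 ⟨_, (hK f g).2 h⟩, fun F => ?_, fun F F' g g' h h' => ?_⟩
  · obtain ⟨k, hk⟩ := h2 F
    exact ⟨k.1.snd, hk ▸ (hK k.1.fst k.1.snd).1 k.2⟩
  · rw [h3 F F' ⟨_, (hK _ g).2 h⟩ ⟨_, (hK _ g').2 h'⟩ rfl rfl]
    exact WithLp.prod_inner_apply _ _

/-- `H(b)` consists of the `f ∈ H²` for which there is a `g ∈ H²` with `T_b̄ f = T_ā g`, and the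
inner product is the one of the pairs `(f, g)` in `H² ⊕ H²`. -/
theorem HB_structure {b a : LinfT} (hab : IsPair b a) :
    (∀ f g, IsConjugatePair b a f g → ∃ F : HB b, RangeSpace.incl F = f) ∧
    (∀ F : HB b, ∃ g, IsConjugatePair b a (RangeSpace.incl F) g) ∧
    ∀ (F F' : HB b) (g g' : H2), IsConjugatePair b a (RangeSpace.incl F) g →
      IsConjugatePair b a (RangeSpace.incl F') g' →
      ⟪F, F'⟫_ℂ = ⟪RangeSpace.incl F, RangeSpace.incl F'⟫_ℂ + ⟪g, g'⟫_ℂ :=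
  rangeSpace_structure (adjoint_toeplitz b) (adjoint_toeplitz a) (toeplitz_star_mul_self_add hab)
    (fun _ => toeplitz_star_injective hab) (isSelfAdjoint_defect b) (defect_defect hab)

/-! ### The shift on `H(b)` -/

/-- The constant function `1` in `H²`. -/
def oneH2 : H2 := ⟨polyL2 1, one_mem_H2⟩

theorem inner_mulL_poly_self_shift (f g : L2T) :
    ⟪mulL (polyInf Polynomial.X) f, mulL (polyInf Polynomial.X) g⟫_ℂ = ⟪f, g⟫_ℂ := by
  rw [inner_eq_integral, inner_eq_integral]
  refine integral_congr_ae ?_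
  filter_upwards [mulL_poly_coeFn Polynomial.X f, mulL_poly_coeFn Polynomial.X g] with t h1 h2
  rw [h1, h2, Polynomial.eval_X, map_mul]
  linear_combination conj (f t) * g t * zeta_mul_conj t

theorem exists_eq_smul_one {f : H2}
    (h : ∀ n : ℕ, ⟪polyL2 (Polynomial.X ^ (n + 1)), (f : L2T)⟫_ℂ = 0) : ∃ c : ℂ, f = c • oneH2 := by
  obtain ⟨R, hR, hf⟩ := exists_polyL2_eq f.2 (m := 0) fun n hn => by
    obtain ⟨k, rfl⟩ := Nat.exists_eq_add_of_le' hn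
    rw [fourierCoeff_eq_inner, ← polyL2_X_pow, h k]
  refine ⟨R.coeff 0, Subtype.ext ?_⟩
  rw [hf, Polynomial.eq_C_of_natDegree_le_zero hR, ← Polynomial.monomial_zero_left,
    polyL2_monomial]
  simp [oneH2]

/-- Both terms have the same inner product with `z^(n+1)`, namely that of `φ z^n` with `f`, since
multiplication by `z` is isometric. Only the constant coefficient can differ. -/
theorem toeplitz_star_shift_sub (φ : LinfT) (f : H2) :
    ∃ c : ℂ, toeplitz (star φ) (shift f) - shift (toeplitz (star φ) f) = c • oneH2 := by
  refine exists_eq_smul_one fun n => ?_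
  have h1 : (⟨polyL2 (Polynomial.X ^ (n + 1)), polyL2_mem_H2 _⟩ : H2) =
      shift ⟨polyL2 (Polynomial.X ^ n), polyL2_mem_H2 _⟩ := by
    refine Subtype.ext ?_
    rw [shift_coe, mulL_poly_poly, ← pow_succ']
  change ⟪(⟨polyL2 (Polynomial.X ^ (n + 1)), polyL2_mem_H2 _⟩ : H2),
    toeplitz (star φ) (shift f) - shift (toeplitz (star φ) f)⟫_ℂ = 0
  rw [inner_sub_right, inner_toeplitz_star_right, h1, Submodule.coe_inner (x := shift _),
    shift_coe, shift_coe, shift_coe, inner_mulL_poly_self_shift, mulL_comm,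
    inner_mulL_poly_self_shift, ← Submodule.coe_inner, inner_toeplitz_star_right, sub_self]

theorem toeplitz_star_one {b a : LinfT} (hab : IsPair b a) :
    ∃ d : ℂ, d ≠ 0 ∧ toeplitz (star a) oneH2 = d • oneH2 := by
  obtain ⟨d, hd⟩ : ∃ d : ℂ, toeplitz (star a) oneH2 = d • oneH2 := by
    refine exists_eq_smul_one fun n => ?_
    change ⟪(⟨polyL2 (Polynomial.X ^ (n + 1)), polyL2_mem_H2 _⟩ : H2), _⟫_ℂ = 0
    rw [inner_toeplitz_star_right]
    have h1 := fourierCoeff_mulL_X_pow (mulL_one_mem_H2 hab.2.2.1) (Nat.le_add_left 1 n)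
    rw [mulL_comm, mulL_poly_polyL2_one, fourierCoeff_eq_inner, ← one_eq_fourierLp,
      ← inner_conj_symm, map_eq_zero] at h1
    exact h1
  refine ⟨d, ?_, hd⟩
  rintro rfl
  rw [zero_smul] at hd
  have h2 : polyL2 1 = 0 := congrArg Subtype.val (toeplitz_star_injective hab hd)
  have h3 : ‖(fourierLp 2 0 : L2T)‖ = 1 := orthonormal_fourier.1 0
  rw [← one_eq_fourierLp, h2, norm_zero] at h3
  exact zero_ne_one h3

theorem IsConjugatePair.shift {b a : LinfT} (hab : IsPair b a) {f g : H2}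
    (h : IsConjugatePair b a f g) : ∃ c : ℂ, IsConjugatePair b a (shift f) (shift g + c • oneH2) := by
  obtain ⟨c₁, h1⟩ := toeplitz_star_shift_sub b f
  obtain ⟨c₂, h2⟩ := toeplitz_star_shift_sub a g
  obtain ⟨d, hd, h3⟩ := toeplitz_star_one hab
  -- The constant added to `S g` must compensate the two commutator defects `c₁` and `c₂`, and `T_ā`
  -- acts on constants as multiplication by `d ≠ 0`.
  refine ⟨(c₁ - c₂) / d, ?_⟩
  rw [IsConjugatePair] at h ⊢
  rw [map_add, map_smul, h3, smul_smul, div_mul_cancel₀ _ hd, sub_smul, ← h1, ← h2, h]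
  abel

/-- The restriction of the shift to `H(b)`. -/
theorem exists_shift_HB {b a : LinfT} (hab : IsPair b a) : ∃ Y : HB b →ₗ[ℂ] HB b,
    ∀ f : HB b, RangeSpace.incl (Y f) = shift (RangeSpace.incl f) := by
  obtain ⟨h1, h2, -⟩ := HB_structure hab
  have h : ∀ F : HB b, ∃ F' : HB b, RangeSpace.incl F' = shift (RangeSpace.incl F) := fun F => by
    obtain ⟨g, hg⟩ := h2 F
    obtain ⟨c, hc⟩ := hg.shift hab
    exact h1 _ _ hc
  choose Y hY using h
  refine ⟨⟨⟨Y, fun F G => ?_⟩, fun c F => ?_⟩, hY⟩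
  · exact RangeSpace.incl_injective (by simp only [map_add, hY])
  · exact RangeSpace.incl_injective (by simp only [map_smul, hY, RingHom.id_apply])

theorem incl_aeval {b : LinfT} {Y : HB b →ₗ[ℂ] HB b}
    (hY : ∀ f : HB b, RangeSpace.incl (Y f) = shift (RangeSpace.incl f)) (P : Polynomial ℂ)
    (h : HB b) : (RangeSpace.incl (A := defect b) (Polynomial.aeval Y P h) : L2T) =
      mulL (polyInf P) (RangeSpace.incl (A := defect b) h : L2T) := by
  have hpow : ∀ n : ℕ, (RangeSpace.incl (A := defect b) ((Y ^ n) h) : L2T) =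
      mulL (polyInf (Polynomial.X ^ n)) (RangeSpace.incl (A := defect b) h : L2T) := by
    intro n
    induction n with
    | zero => rw [pow_zero, pow_zero, mulL_poly_one]; rfl
    | succ n ih => rw [pow_succ', pow_succ', Module.End.mul_apply, hY, shift_coe, ih, mulL_poly_mul]
  rw [← polyMul_apply]
  induction P using Polynomial.induction_on' with
  | add P Q h1 h2 =>
    rw [map_add, map_add, LinearMap.add_apply, map_add, Submodule.coe_add, h1, h2]
  | monomial n c =>
    rw [← Polynomial.smul_X_eq_monomial, map_smul, map_smul, map_pow, Polynomial.aeval_X,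
      LinearMap.smul_apply, map_smul, Submodule.coe_smul, hpow, polyMul_apply]

/-! ### Wandering vectors of the shift on `H(b)`. -/

theorem inner_aeval_eq_zero {E : Type*} [NormedAddCommGroup E] [InnerProductSpace ℂ E]
    {Y : E →ₗ[ℂ] E} {h : E} (hh : IsWandering Y h) (P : Polynomial ℂ) :
    ⟪Polynomial.aeval Y (Polynomial.X * P) h, h⟫_ℂ = 0 := by
  induction P using Polynomial.induction_on' with
  | add P Q h1 h2 => rw [mul_add, map_add, LinearMap.add_apply, inner_add_left, h1, h2, add_zero]
  | monomial n c =>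
    rw [← Polynomial.smul_X_eq_monomial, mul_smul_comm, ← pow_succ', map_smul, map_pow,
      Polynomial.aeval_X, LinearMap.smul_apply, inner_smul_left, hh.2 _ (Nat.le_add_left 1 n),
      mul_zero]

/-- The polynomial that is `z^m` times the complex conjugate of `P` on the circle. -/
def conjReverse (m : ℕ) (P : Polynomial ℂ) : Polynomial ℂ :=
  ∑ i ∈ Finset.range (m + 1), Polynomial.monomial (m - i) (conj (P.coeff i))

theorem eval_conjReverse {m : ℕ} {P : Polynomial ℂ} (hP : P.natDegree ≤ m) (t : UCircle) :
    (conjReverse m P).eval (zeta t) = zeta t ^ m * conj (P.eval (zeta t)) := by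
  rw [conjReverse, Polynomial.eval_finsetSum, Polynomial.eval_eq_sum_range' (n := m + 1) (by omega),
    map_sum, Finset.mul_sum]
  refine Finset.sum_congr rfl fun i hi => ?_
  have hi' : i ≤ m := by simpa [Nat.lt_succ_iff] using hi
  obtain ⟨k, rfl⟩ := Nat.exists_eq_add_of_le hi'
  have h1 : zeta t ^ i * conj (zeta t) ^ i = 1 := by rw [← mul_pow, zeta_mul_conj, one_pow]
  rw [Polynomial.eval_monomial, Nat.add_sub_cancel_left, map_mul, map_pow, pow_add]
  linear_combination (-conj (P.coeff i) * zeta t ^ k) * h1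

/-- For a wandering vector `f`, the function `|R f|²` has no Fourier coefficients of index `> m`. -/
theorem inner_mulL_wandering {m : ℕ} {p q R : Polynomial ℂ} (hp : p.natDegree ≤ m)
    (hq : q.natDegree ≤ m) {b a : LinfT} (hab : IsPair b a)
    (hnorm : ∀ t, ‖R.eval (zeta t)‖ ^ 2 = ‖p.eval (zeta t)‖ ^ 2 + ‖q.eval (zeta t)‖ ^ 2)
    (hR : ∀ᵐ t ∂𝔪, R.eval (zeta t) * a t = q.eval (zeta t) ∧
        R.eval (zeta t) * b t = p.eval (zeta t))
    {Y : HB b →ₗ[ℂ] HB b}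
    (hY : ∀ f : HB b, RangeSpace.incl (Y f) = shift (RangeSpace.incl f)) {h : HB b}
    (hh : IsWandering Y h) {k : ℕ} (hk : m < k) :
    ∫ t, zeta t ^ k * (‖R.eval (zeta t)‖ ^ 2 * ‖(RangeSpace.incl (A := defect b) h : L2T) t‖ ^ 2 : ℝ) ∂𝔪 = 0 := by
  obtain ⟨j, rfl⟩ := Nat.exists_eq_add_of_lt hk
  obtain ⟨-, h2, h3⟩ := HB_structure hab
  set f := RangeSpace.incl h with hf
  obtain ⟨g, hg⟩ := h2 h
  set y : L2T := mulL (polyInf (Polynomial.X ^ (j + 1) * conjReverse m p)) (f : L2T) with hy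
  have hyH : y ∈ H2 := mulL_poly_mem_H2 _ f.2
  set F := Polynomial.aeval Y (Polynomial.X * (Polynomial.X ^ j * q * conjReverse m q)) h with hF
  have hFc := incl_aeval hY (Polynomial.X * (Polynomial.X ^ j * q * conjReverse m q)) h
  -- Since `conj b · conj q = conj a · conj p` on the circle, `conj b · z^(j+1) q q# f` and `conj a
  -- · z^(j+1) q p# f` coincide even before projection, which gives an explicit partner of `F`.
  have hpairF : IsConjugatePair b a (RangeSpace.incl F)
      ⟨mulL (polyInf q) y, mulL_poly_mem_H2 _ hyH⟩ := by
    rw [isConjugatePair_iff]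
    intro x hx
    rw [hF, hFc, inner_eq_integral, inner_eq_integral]
    refine integral_congr_ae ?_
    filter_upwards [hR, mulL_coeFn b x, mulL_coeFn a x,
      mulL_poly_coeFn (Polynomial.X * (Polynomial.X ^ j * q * conjReverse m q)) (f : L2T),
      mulL_poly_coeFn q y,
      mulL_poly_coeFn (Polynomial.X ^ (j + 1) * conjReverse m p) (f : L2T)] with t e1 e2 e3 e4 e5 e6
    have e7 : conj (b t) * conj (q.eval (zeta t)) = conj (a t) * conj (p.eval (zeta t)) := by
      rw [← e1.1, ← e1.2, map_mul, map_mul]; ring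
    rw [e2, e3, e4, e5, hy, e6]
    simp only [Polynomial.eval_mul, Polynomial.eval_pow, Polynomial.eval_X, eval_conjReverse hp,
      eval_conjReverse hq, map_mul]
    linear_combination (conj (x t) * zeta t ^ (j + 1) * zeta t ^ m * q.eval (zeta t) *
      (f : L2T) t) * e7
  have horth := inner_aeval_eq_zero hh (Polynomial.X ^ j * q * conjReverse m q)
  rw [← hF, h3 F h _ g hpairF hg, Submodule.coe_inner, Submodule.coe_inner, hF, hFc] at horth
  -- The unknown partner `g` is eliminated: as `q = a R` and `p = b R`, testing `T_b̄ f = T_ā g`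
  -- against `R y` exchanges `q, g` for `p, f`.
  have hqp : ⟪mulL (polyInf q) y, (g : L2T)⟫_ℂ = ⟪mulL (polyInf p) y, (f : L2T)⟫_ℂ := by
    have h4 := isConjugatePair_iff.1 hg _ (mulL_poly_mem_H2 R hyH)
    have h5 : mulL b (mulL (polyInf R) y) = mulL (polyInf p) y := by
      rw [mulL_eq_iff]
      filter_upwards [hR, mulL_poly_coeFn R y, mulL_poly_coeFn p y] with t e1 e2 e3
      rw [e2, e3, ← e1.2]; ring
    have h6 : mulL a (mulL (polyInf R) y) = mulL (polyInf q) y := by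
      rw [mulL_eq_iff]
      filter_upwards [hR, mulL_poly_coeFn R y, mulL_poly_coeFn q y] with t e1 e2 e3
      rw [e2, e3, ← e1.1]; ring
    rw [h5, h6] at h4
    exact h4.symm
  change _ + ⟪mulL (polyInf q) y, (g : L2T)⟫_ℂ = 0 at horth
  rw [hqp, inner_eq_integral, inner_eq_integral,
    ← integral_add (integrable_conj_mul _ _) (integrable_conj_mul _ _)] at horth
  rw [← map_eq_zero (starRingEnd ℂ), ← integral_conj, ← horth]
  refine integral_congr_ae ?_
  filter_upwards [mulL_poly_coeFn (Polynomial.X * (Polynomial.X ^ j * q * conjReverse m q))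
    (f : L2T), mulL_poly_coeFn p y,
    mulL_poly_coeFn (Polynomial.X ^ (j + 1) * conjReverse m p) (f : L2T)] with t e1 e2 e3
  rw [e1, e2, hy, e3, hnorm t]
  simp only [Polynomial.eval_mul, Polynomial.eval_pow, Polynomial.eval_X, eval_conjReverse hp,
      eval_conjReverse hq, map_mul, map_pow, Complex.conj_conj, Complex.conj_ofReal]
  rw [Complex.ofReal_mul, Complex.ofReal_add, ← mul_norm_sq, ← mul_norm_sq, ← mul_norm_sq]
  ring

/-- The outer part of a wandering vector of the shift on `H(b)` lies in the model space. -/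
theorem outerPart_mem_modelSpace {m : ℕ} {p q R : Polynomial ℂ} (hp : p.natDegree ≤ m)
    (hq : q.natDegree ≤ m) {b a : LinfT} (hab : IsPair b a)
    (hnorm : ∀ t, ‖R.eval (zeta t)‖ ^ 2 = ‖p.eval (zeta t)‖ ^ 2 + ‖q.eval (zeta t)‖ ^ 2)
    (hR : ∀ᵐ t ∂𝔪, R.eval (zeta t) * a t = q.eval (zeta t) ∧
        R.eval (zeta t) * b t = p.eval (zeta t))
    (hcyc : polyL2 1 ∈ cyc (polyL2 R)) {α : Fin m → ℂ} (hα : ∀ j, ‖α j‖ < 1) {c : ℂ} (hc : c ≠ 0)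
    (hRα : R = Polynomial.C c * ∏ j, (1 - Polynomial.C (conj (α j)) * Polynomial.X)) {B : LinfT}
    (hB : ∀ᵐ t ∂𝔪, B t = ∏ j, (zeta t - α j) / (1 - conj (α j) * zeta t))
    {Y : HB b →ₗ[ℂ] HB b}
    (hY : ∀ f : HB b, RangeSpace.incl (Y f) = shift (RangeSpace.incl f)) {h : HB b}
    (hh : IsWandering Y h) {h₀ : H2} (h0 : IsOuterPart h₀ (RangeSpace.incl h)) :
    h₀ ∈ modelSpace (zInf • B : LinfT) := by
  obtain ⟨hout, u, ⟨-, hu⟩, huh⟩ := h0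
  have hF : polyL2 1 ∈ cyc (mulL (polyInf R) (h₀ : L2T)) :=
    one_mem_cyc_mulL (hout.one_mem_cyc (ae_eq_refl _)) (by rwa [mulL_poly_polyL2_one])
  -- As `|u| = 1`, the moduli of `R h₀` and of `R` times the wandering vector agree, so the
  -- vanishing of coefficients beyond `m` carries over to the cyclic function `R h₀`.
  refine mem_modelSpace hα hc hRα hcyc hB fun x hx => inner_X_pow_eq_zero hF (fun k hk => ?_) hx
  rw [inner_eq_integral, ← inner_mulL_wandering hp hq hab hnorm hR hY hh hk]
  refine integral_congr_ae ?_
  filter_upwards [mulL_poly_coeFn R (h₀ : L2T),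
    mulL_poly_coeFn (Polynomial.X ^ k) (mulL (polyInf R) (h₀ : L2T)), hu, huh] with t e1 e2 e3 e4
  rw [e2, e1, e4, norm_mul, e3, one_mul, Complex.ofReal_mul, ← mul_norm_sq, ← mul_norm_sq,
    Polynomial.eval_pow, Polynomial.eval_X, map_mul]
  ring

end DeBrangesRovnyak

end

/-! ### The main theorem. -/

open DeBrangesRovnyak MeasureTheory AddCircle
open scoped ENNReal
theorem theorem2 (m : ℕ) (lam : Fin m → ℂ) (hlam : ∀ j, ‖lam j‖ = 1)
    (p : Polynomial ℂ) (hdeg : p.natDegree ≤ m) (hp : ∀ j, p.eval (lam j) ≠ 0)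
    (b a : LinfT) (hba : IsRationalPair b a)
    (hφ : ∀ᵐ t ∂(haarAddCircle (T := 2 * Real.pi)),
      b t / a t = p.eval (zeta t) / ∏ j, (1 - (starRingEnd ℂ) (lam j) * zeta t)) :
    ∃ Y : HB b →ₗ[ℂ] HB b,
      (∀ f : HB b, RangeSpace.incl (Y f) = shift (RangeSpace.incl f)) ∧
      ∃ B : LinfT, IsFiniteBlaschke m B ∧
        ∀ h : HB b, IsWandering Y h →
          ∀ h₀ : H2, IsOuterPart h₀ (RangeSpace.incl h) →
            h₀ ∈ modelSpace (zInf • B : LinfT) := by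
  have hab := hba.1
  obtain ⟨Y, hY⟩ := exists_shift_HB hab
  set q : Polynomial ℂ :=
    ∏ j, (1 - Polynomial.C ((starRingEnd ℂ) (lam j)) * Polynomial.X) with hq
  have hqeval : ∀ w : ℂ, q.eval w = ∏ j, (1 - (starRingEnd ℂ) (lam j) * w) := fun w => by
    rw [hq, Polynomial.eval_prod]; simp
  have hq0 : q ≠ 0 := by
    intro h
    have h1 := hqeval 0
    simp [h] at h1
  have hqdeg : q.natDegree ≤ m := by
    refine (Polynomial.natDegree_prod_le _ _).trans ?_
    have h1 : ∀ j : Fin m,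
        (1 - Polynomial.C ((starRingEnd ℂ) (lam j)) * Polynomial.X).natDegree ≤ 1 := fun j =>
      (Polynomial.natDegree_sub_le _ _).trans (by
        rw [Polynomial.natDegree_one]
        exact max_le zero_le_one ((Polynomial.natDegree_C_mul_le _ _).trans Polynomial.natDegree_X_le))
    simpa using Finset.sum_le_sum fun j (_ : j ∈ Finset.univ) => h1 j
  -- On the circle, where `|R|² = |p|² + |q|²`, this excludes zeros of `R`.
  have hcop : ∀ w : ℂ, ‖w‖ = 1 → q.eval w = 0 → p.eval w ≠ 0 := by
    intro w _ hw
    rw [hqeval, Finset.prod_eq_zero_iff] at hw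
    obtain ⟨j, -, hj⟩ := hw
    have h1 : (starRingEnd ℂ) (lam j) * lam j = 1 := by rw [Complex.conj_mul', hlam]; simp
    have h2 : lam j = w := by linear_combination lam j * hj + w * h1
    exact h2 ▸ hp j
  obtain ⟨R, hRdeg, hcyc, hR0, hnorm, hR⟩ := exists_denominator hdeg hqdeg
    (one_mem_cyc_prod Finset.univ _ fun j => by rw [RCLike.norm_conj, hlam])
    (ae_eval_zeta_ne_zero hq0) hcop hab (by simpa only [hqeval] using hφ)
  obtain ⟨c, α, hc, hα, hRα⟩ := exists_prod_eq m R hRdeg hR0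
  obtain ⟨B, hB, hBα⟩ := exists_blaschke hα
  exact ⟨Y, hY, B, hB, fun h hh h₀ h0 =>
    outerPart_mem_modelSpace hdeg hqdeg hab hnorm hR hcyc hα hc hRα hBα hY hh h0⟩
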